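/- **Notation.** Let $R$ be a commutative ring. For a ring $R'$, let $\mathcal{B}(R,R')$ be the abelian category of functors $F$ from finitely generated projective $R$-modules to $R'$-modules with $F(0)=0$ (exactness is pointwise), and put $\mathcal{B}(R)=\mathcal{B}(R,R)$. For an $R$-bimodule $M$ let ${\sf I}(M)\in\mathcal{B}(R)$ be the functor $V\mapsto M\otimes_R V$, and let ${\sf I}={\sf I}(R)$ be the tautological functor. An *elementary extension* of $R$ by $M$ is an exact sequence $$0\to {\sf I}(M)\xrightarrow{b} C_1\xrightarrow{d} C_0\xrightarrow{a}{\sf I}\to 0$$ in $\mathcal{B}(R)$; maps of elementary extensions are maps of such sequences that are the identity on ${\sf I}(M)$ and ${\sf I}$. It is *multiplicative* if the complex $C_\bullet=(C_1\to C_0)$, in degrees $1$ and $0$, carries an $R$-linear unit map $R\to C_0(R)$ and functorial maps of complexes $C_\bullet(V)\otimes_R C_\bullet(V')\to C_\bullet(V\otimes_R V')$ that are associative and unital, and $a:C_\bullet\to{\sf I}$ is compatible with units and products. A *square-zero extension* of $R$ by $M$ is a ring $R'$ with a short exact sequence of abelian groups $0\to M\xrightarrow{i}R'\xrightarrow{q}R\to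 0$ such that $q$ is a unital ring map, $i(m)r'=i(m\,q(r'))$, $r'i(m)=i(q(r')m)$ and $i(m)i(m')=0$. Let $q_*({\sf I})\in\mathcal{B}(R,R')$ be the functor sending $V$ to $V$ regarded as an $R'$-module via $q$, and let $q^*:\mathcal{B}(R,R')\to\mathcal{B}(R)$ be $F\mapsto R\otimes_{R'}F(-)$. For a projective resolution $P_\bullet$ of $q_*({\sf I})$ in $\mathcal{B}(R,R')$, the canonical truncation $\tau_{[0,1]}q^*P_\bullet$, given by $\operatorname{Coker}(q^*P_2\to q^*P_1)\to q^*P_0$, is an elementary extension of $R$ by $M$; here $H_0(q^*P_\bullet(V))=R\otimes_{R'}V$ is identified with $V$, and $H_1(q^*P_\bullet(V))=\operatorname{Tor}_1^{R'}(R,V)$ is identified with $M\otimes_R V$ by the connecting map of $0\to M\to R'\to R\to 0$. An elementary extension $\phi$ *corresponds* to $R'$ if such resolutions $P_\bullet$ exist and, for every one of them, $\phi$ and $\tau_{[0,1]}q^*P_\bullet$ are connected by a zigzag of maps of elementary extensions. **Proposition.** Let $R$ be a commutative ring, $M$ an $R$-bimodule, and $R'$ a square-zero extension of $R$ by $M$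 such that the ring $R'$ is commutative. Then $M$ is diagonal, that is, $rm=mr$ for all $r\in R$, $m\in M$, and there is a multiplicative elementary extension $\phi$ of $R$ by $M$ that corresponds to $R'$. -/

import Mathlib

open CategoryTheory TensorProduct

universe u

namespace MacLane

noncomputable section

/-! ### Pointed functors on finitely generated projective modules -/

/-- The property of being a finitely generated projective `R`-module. -/
def isFGProj (R : Type u) [Ring R] : ObjectProperty (ModuleCat.{u} R) :=
  fun V => Module.Finite R V ∧ Module.Projective R V

/-- The category `R-proj` of finitely generated projective left `R`-modules. -/
abbrev RProj (R : Type u) [Ring R] := (isFGProj R).FullSubcategory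

/-- A functor `F : R-proj ⥤ R'-mod` is pointed if `F(0) = 0`. -/
def isPointed (R R' : Type u) [Ring R] [Ring R'] :
    ObjectProperty (RProj R ⥤ ModuleCat.{u} R') :=
  fun F => ∀ V : RProj R, Subsingleton V.obj → Subsingleton (F.obj V)

/-- The category `B(R, R')` of pointed functors from `R-proj` to `R'-mod`. -/
abbrev B (R R' : Type u) [Ring R] [Ring R'] := (isPointed R R').FullSubcategory

/-- The value `F(V)` of a pointed functor. -/
abbrev B.val {R R' : Type u} [Ring R] [Ring R'] (F : B R R') (V : RProj R) : ModuleCat.{u} R' :=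
  F.obj.obj V

/-- The map `F(V) → F(W)` induced by `f : V ⟶ W`. -/
abbrev B.map {R R' : Type u} [Ring R] [Ring R'] (F : B R R') {V W : RProj R} (f : V ⟶ W) :
    F.val V →ₗ[R'] F.val W :=
  (F.obj.map f).hom

/-- The component `F(V) → G(V)` of a morphism of pointed functors. -/
abbrev B.app {R R' : Type u} [Ring R] [Ring R'] {F G : B R R'} (t : F ⟶ G) (V : RProj R) :
    F.val V →ₗ[R'] G.val V :=
  (t.hom.app V).hom

/-! ### The functors attached to bimodules -/

section Bimodule

/-- An `R`-module `V` over the commutative ring `R`, seen as a module over `Rᵐᵒᵖ`. -/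
def OpMod (V : Type u) : Type u := V

instance (V : Type u) [AddCommGroup V] : AddCommGroup (OpMod V) :=
  inferInstanceAs (AddCommGroup V)

instance (R V : Type u) [CommRing R] [AddCommGroup V] [Module R V] : Module Rᵐᵒᵖ (OpMod V) :=
  Module.compHom V ((RingHom.id R).fromOpposite mul_comm)

/-- The map of `Rᵐᵒᵖ`-modules underlying an `R`-linear map. -/
def OpMod.map {R V W : Type u} [CommRing R] [AddCommGroup V] [Module R V]
    [AddCommGroup W] [Module R W] (f : V →ₗ[R] W) : OpMod V →ₗ[Rᵐᵒᵖ] OpMod W where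
  toFun := f
  map_add' := f.map_add
  map_smul' r v := f.map_smul r.unop v

variable (R M : Type u) [CommRing R] [AddCommGroup M] [Module R M] [Module Rᵐᵒᵖ M]

/-- The tensor product `M ⊗_R V` of an `R`-bimodule `M` and an `R`-module `V`: the relations are
`m r ⊗ v = m ⊗ r v`, and `R` acts through the left action on `M`. -/
abbrev BimodTensor (V : Type u) [AddCommGroup V] [Module R V] : Type u :=
  M ⊗[Rᵐᵒᵖ] OpMod V

/-- The pure tensor `m ⊗ v` in `M ⊗_R V`. -/
def btmul {V : Type u} [AddCommGroup V] [Module R V] (m : M) (v : V) : BimodTensor R M V :=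
  TensorProduct.tmul Rᵐᵒᵖ m (show OpMod V from v)

variable [SMulCommClass Rᵐᵒᵖ R M]

/-- The `R`-linear map `M ⊗_R V → M ⊗_R W` induced by `f : V → W`. -/
def BimodTensor.map {V W : Type u} [AddCommGroup V] [Module R V] [AddCommGroup W] [Module R W]
    (f : V →ₗ[R] W) : BimodTensor R M V →ₗ[R] BimodTensor R M W where
  toFun := (OpMod.map f).lTensor M
  map_add' := map_add _
  map_smul' r x := by
    induction x using TensorProduct.induction_on with
    | zero => simp
    | tmul m v => simp [TensorProduct.smul_tmul']
    | add x y hx hy => simp only [smul_add, map_add, hx, hy]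

/-- The functor `I(M) : V ↦ M ⊗_R V` in `B(R, R)` attached to an `R`-bimodule `M`. -/
def bimodFunctor : B R R where
  obj :=
    { obj := fun V => ModuleCat.of R (BimodTensor R M V.obj)
      map := fun f => ModuleCat.ofHom (BimodTensor.map R M f.hom.hom)
      map_id := fun V => by
        apply ModuleCat.hom_ext
        apply LinearMap.ext
        intro x
        exact LinearMap.congr_fun (LinearMap.lTensor_id M (OpMod V.obj) (R := Rᵐᵒᵖ)) x
      map_comp := fun f g => by
        apply ModuleCat.hom_ext
        apply LinearMap.ext
        intro x
        exact LinearMap.congr_fun (LinearMap.lTensor_comp M (OpMod.map g.hom.hom)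
          (OpMod.map f.hom.hom)) x }
  property := fun V hV => by
    refine ⟨fun x y => ?_⟩
    have key : ∀ z : BimodTensor R M V.obj, z = 0 := by
      intro z
      induction z using TensorProduct.induction_on with
      | zero => rfl
      | tmul m v =>
        have : v = 0 := hV.elim v (0 : V.obj)
        rw [this, TensorProduct.tmul_zero]
      | add x y hx hy => rw [hx, hy, add_zero]
    exact (key x).trans (key y).symm

end Bimodule

/-- The tautological functor `I` in `B(R, R)`: the embedding of `R-proj` in `R-mod`. -/
def tautFunctor (R : Type u) [CommRing R] : B R R where
  obj := (isFGProj R).ι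
  property := fun _ hV => hV

/-! ### Elementary extensions -/

/-- An elementary extension of `R` by the `R`-bimodule `M`: an exact sequence
`0 → I(M) → C₁ → C₀ → I → 0` in `B(R, R)` (exactness is computed pointwise). -/
structure ElemExt (R M : Type u) [CommRing R] [AddCommGroup M] [Module R M] [Module Rᵐᵒᵖ M]
    [SMulCommClass Rᵐᵒᵖ R M] where
  C₁ : B R R
  C₀ : B R R
  b : bimodFunctor R M ⟶ C₁
  d : C₁ ⟶ C₀
  a : C₀ ⟶ tautFunctor R
  b_injective : ∀ V, Function.Injective (B.app b V)
  exact₁ : ∀ V, Function.Exact (B.app b V) (B.app d V)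
  exact₀ : ∀ V, Function.Exact (B.app d V) (B.app a V)
  a_surjective : ∀ V, Function.Surjective (B.app a V)

namespace ElemExt

variable {R M : Type u} [CommRing R] [AddCommGroup M] [Module R M] [Module Rᵐᵒᵖ M]
  [SMulCommClass Rᵐᵒᵖ R M]

/-- A map of elementary extensions: a map of complexes that is the identity on `I(M)` and `I`. -/
@[ext]
structure Hom (φ ψ : ElemExt R M) where
  f₁ : φ.C₁ ⟶ ψ.C₁
  f₀ : φ.C₀ ⟶ ψ.C₀
  comm_b : φ.b ≫ f₁ = ψ.b
  comm_d : f₁ ≫ ψ.d = φ.d ≫ f₀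
  comm_a : f₀ ≫ ψ.a = φ.a

/-- The category of elementary extensions of `R` by `M`. -/
instance : Category (ElemExt R M) where
  Hom φ ψ := Hom φ ψ
  id φ := ⟨𝟙 _, 𝟙 _, by simp, by simp, by simp⟩
  comp {φ ψ χ} f g := ⟨f.f₁ ≫ g.f₁, f.f₀ ≫ g.f₀,
    by rw [← Category.assoc, f.comm_b, g.comm_b],
    by rw [Category.assoc, g.comm_d, ← Category.assoc, f.comm_d, Category.assoc],
    by rw [Category.assoc, g.comm_a, f.comm_a]⟩
  id_comp f := Hom.ext (Category.id_comp _) (Category.id_comp _)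
  comp_id f := Hom.ext (Category.comp_id _) (Category.comp_id _)
  assoc f g h := Hom.ext (Category.assoc _ _ _) (Category.assoc _ _ _)

end ElemExt

/-! ### Multiplicative elementary extensions -/

namespace RProj

variable {R : Type u} [CommRing R]

/-- The unit object `R` of `R-proj`. -/
def one (R : Type u) [CommRing R] : RProj R where
  obj := ModuleCat.of R R
  property := ⟨inferInstanceAs (Module.Finite R R), inferInstanceAs (Module.Projective R R)⟩

/-- The tensor product `V ⊗_R W` of finitely generated projective modules. -/
def tensor (V W : RProj R) : RProj R where
  obj := ModuleCat.of R (V.obj ⊗[R] W.obj)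
  property := by
    have := V.property.1
    have := W.property.1
    have := V.property.2
    have := W.property.2
    exact ⟨inferInstanceAs (Module.Finite R (V.obj ⊗[R] W.obj)),
      inferInstanceAs (Module.Projective R (V.obj ⊗[R] W.obj))⟩

/-- The tensor product of two maps. -/
def tensorMap {V V' W W' : RProj R} (f : V ⟶ V') (g : W ⟶ W') : tensor V W ⟶ tensor V' W' :=
  ObjectProperty.homMk (ModuleCat.ofHom (TensorProduct.map f.hom.hom g.hom.hom))

/-- The associativity map `(U ⊗ V) ⊗ W → U ⊗ (V ⊗ W)`. -/
def assoc (U V W : RProj R) : tensor (tensor U V) W ⟶ tensor U (tensor V W) :=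
  ObjectProperty.homMk
    (ModuleCat.ofHom (TensorProduct.assoc R U.obj V.obj W.obj).toLinearMap)

/-- The left unit map `R ⊗ V → V`. -/
def lid (V : RProj R) : tensor (one R) V ⟶ V :=
  ObjectProperty.homMk (ModuleCat.ofHom (TensorProduct.lid R V.obj).toLinearMap)

/-- The right unit map `V ⊗ R → V`. -/
def rid (V : RProj R) : tensor V (one R) ⟶ V :=
  ObjectProperty.homMk (ModuleCat.ofHom (TensorProduct.rid R V.obj).toLinearMap)

end RProj

/-- A multiplicative structure on an elementary extension `φ`: the complex `C₁ → C₀` (in degrees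
`1` and `0`) carries a unit `e : R → C₀(R)` and functorial maps of complexes
`C(V) ⊗_R C(V') → C(V ⊗_R V')` that are associative and unital, and the augmentation `a : C → I`
is multiplicative. The maps are given by their components `C₀ ⊗ C₀ → C₀`, `C₀ ⊗ C₁ → C₁` and
`C₁ ⊗ C₀ → C₁`; the component on `C₁ ⊗ C₁` vanishes because `C₂ = 0`, and so do both sides of any
identity between terms of degree at least `2`. -/
structure MultStructure {R M : Type u} [CommRing R] [AddCommGroup M] [Module R M] [Module Rᵐᵒᵖ M]
    [SMulCommClass Rᵐᵒᵖ R M] (φ : ElemExt R M) where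
  e : R →ₗ[R] φ.C₀.val (RProj.one R)
  m₀₀ : ∀ V V' : RProj R,
    φ.C₀.val V →ₗ[R] φ.C₀.val V' →ₗ[R] φ.C₀.val (RProj.tensor V V')
  m₀₁ : ∀ V V' : RProj R,
    φ.C₀.val V →ₗ[R] φ.C₁.val V' →ₗ[R] φ.C₁.val (RProj.tensor V V')
  m₁₀ : ∀ V V' : RProj R,
    φ.C₁.val V →ₗ[R] φ.C₀.val V' →ₗ[R] φ.C₁.val (RProj.tensor V V')
  -- functoriality
  nat₀₀ : ∀ {V V' W W' : RProj R} (f : V ⟶ W) (g : V' ⟶ W') x y,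
    φ.C₀.map (RProj.tensorMap f g) (m₀₀ V V' x y) = m₀₀ W W' (φ.C₀.map f x) (φ.C₀.map g y)
  nat₀₁ : ∀ {V V' W W' : RProj R} (f : V ⟶ W) (g : V' ⟶ W') x y,
    φ.C₁.map (RProj.tensorMap f g) (m₀₁ V V' x y) = m₀₁ W W' (φ.C₀.map f x) (φ.C₁.map g y)
  nat₁₀ : ∀ {V V' W W' : RProj R} (f : V ⟶ W) (g : V' ⟶ W') x y,
    φ.C₁.map (RProj.tensorMap f g) (m₁₀ V V' x y) = m₁₀ W W' (φ.C₁.map f x) (φ.C₀.map g y)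
  -- compatibility with the differentials (Leibniz rule)
  d_m₀₁ : ∀ V V' x y, B.app φ.d _ (m₀₁ V V' x y) = m₀₀ V V' x (B.app φ.d V' y)
  d_m₁₀ : ∀ V V' x y, B.app φ.d _ (m₁₀ V V' x y) = m₀₀ V V' (B.app φ.d V x) y
  d_m₁₁ : ∀ V V' x y, m₀₁ V V' (B.app φ.d V x) y = m₁₀ V V' x (B.app φ.d V' y)
  -- associativity
  assoc₀₀₀ : ∀ U V W x y z, φ.C₀.map (RProj.assoc U V W) (m₀₀ _ W (m₀₀ U V x y) z) =
    m₀₀ U _ x (m₀₀ V W y z)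
  assoc₁₀₀ : ∀ U V W x y z, φ.C₁.map (RProj.assoc U V W) (m₁₀ _ W (m₁₀ U V x y) z) =
    m₁₀ U _ x (m₀₀ V W y z)
  assoc₀₁₀ : ∀ U V W x y z, φ.C₁.map (RProj.assoc U V W) (m₁₀ _ W (m₀₁ U V x y) z) =
    m₀₁ U _ x (m₁₀ V W y z)
  assoc₀₀₁ : ∀ U V W x y z, φ.C₁.map (RProj.assoc U V W) (m₀₁ _ W (m₀₀ U V x y) z) =
    m₀₁ U _ x (m₀₁ V W y z)
  -- unitality
  e_m₀₀ : ∀ V r x, φ.C₀.map (RProj.lid V) (m₀₀ _ V (e r) x) = r • x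
  e_m₀₁ : ∀ V r x, φ.C₁.map (RProj.lid V) (m₀₁ _ V (e r) x) = r • x
  m₀₀_e : ∀ V x r, φ.C₀.map (RProj.rid V) (m₀₀ V _ x (e r)) = r • x
  m₁₀_e : ∀ V x r, φ.C₁.map (RProj.rid V) (m₁₀ V _ x (e r)) = r • x
  -- multiplicativity of the augmentation
  a_e : ∀ r : R, B.app φ.a (RProj.one R) (e r) = (show R from r)
  a_m₀₀ : ∀ V V' x y, B.app φ.a (RProj.tensor V V') (m₀₀ V V' x y) =
    (show V.obj from B.app φ.a V x) ⊗ₜ[R] (show V'.obj from B.app φ.a V' y)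

/-! ### Square-zero extensions and the associated elementary extensions -/

/-- The structure on `R'` of a square-zero extension of the ring `R` by the `R`-bimodule `M`. -/
structure SquareZeroExt (R M R' : Type u) [Ring R] [Ring R'] [AddCommGroup M] [Module R M]
    [Module Rᵐᵒᵖ M] where
  i : M →+ R'
  q : R' →+* R
  i_injective : Function.Injective i
  exact : Function.Exact i q
  q_surjective : Function.Surjective q
  i_mul : ∀ m r, i m * r = i (MulOpposite.op (q r) • m)
  mul_i : ∀ r m, r * i m = i (q r • m)
  i_mul_i : ∀ m m', i m * i m' = 0

section Correspondence

variable {R R' : Type u} [CommRing R] [CommRing R']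

/-- The object `q_*(I)` of `B(R, R')`: the functor that sends `V` to `V` seen as an `R'`-module. -/
def qPushTaut (q : R' →+* R) : B R R' where
  obj := (isFGProj R).ι ⋙ ModuleCat.restrictScalars q
  property := fun _ hV => hV

/-- The functor `q^* : B(R, R') ⥤ B(R, R)`, `(q^* F)(V) = R ⊗_{R'} F(V)`. -/
def qPull (q : R' →+* R) : B R R' ⥤ B R R :=
  (isPointed R R).lift
    ((isPointed R R').ι ⋙ (Functor.whiskeringRight _ _ _).obj (ModuleCat.extendScalars.{u, u, u} q))
    (fun F V hV => by
      have hF : Limits.IsZero (F.obj.obj V) := by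
        have := F.property V hV
        exact ModuleCat.isZero_of_subsingleton _
      exact ModuleCat.subsingleton_of_isZero
        ((ModuleCat.extendScalars.{u, u, u} q).map_isZero hF))

/-- The canonical map `F(V) → R ⊗_{R'} F(V)`, `x ↦ 1 ⊗ x`. -/
def qUnit (q : R' →+* R) (F : B R R') (V : RProj R) (x : F.val V) : ((qPull q).obj F).val V :=
  ((ModuleCat.extendRestrictScalarsAdj.{u, u, u} q).unit.app (F.val V)).hom x

/-- A projective resolution of an object `X` of `B(R, R')` (exactness is computed pointwise). -/
structure ProjRes (X : B R R') where
  P : ChainComplex (B R R') ℕ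
  projective : ∀ n, Projective (P.X n)
  aug : P.X 0 ⟶ X
  aug_surjective : ∀ V, Function.Surjective (B.app aug V)
  exact_zero : ∀ V, Function.Exact (B.app (P.d 1 0) V) (B.app aug V)
  exact_succ : ∀ n V, Function.Exact (B.app (P.d (n + 2) (n + 1)) V) (B.app (P.d (n + 1) n) V)

variable {M : Type u} [AddCommGroup M] [Module R M] [Module Rᵐᵒᵖ M] [SMulCommClass Rᵐᵒᵖ R M]

/-- An identification of the elementary extension `ψ` with the canonical truncation
`τ_{[0,1]} q^* P` of `q^* P`, for a projective resolution `P` of `q_*(I)`. The truncation has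
`q^* P₀` in degree `0` and the cokernel of `q^* P₂ → q^* P₁` in degree `1`; its `0`-th homology is
identified with `I` by the adjoint of the augmentation, and its first homology
`V ↦ L¹q^* (q_* V) = Tor₁^{R'}(R, q_* V)` is identified with `M ⊗_R V` by the connecting map of
`0 → M → R' → R → 0`. Explicitly, that map takes the class of `1 ⊗ w` with `w ∈ P₁(V)` and
`dw = i(m) p`, `p ∈ P₀(V)`, to `m ⊗ v`, where `v` is the image of `p` in `V`. -/
structure TruncationIso (E : SquareZeroExt R M R') (P : ProjRes (qPushTaut E.q))
    (ψ : ElemExt R M) where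
  t₀ : (qPull E.q).obj (P.P.X 0) ≅ ψ.C₀
  t₁ : (qPull E.q).obj (P.P.X 1) ⟶ ψ.C₁
  t₁_surjective : ∀ V, Function.Surjective (B.app t₁ V)
  t₁_exact : ∀ V, Function.Exact (B.app ((qPull E.q).map (P.P.d 2 1)) V) (B.app t₁ V)
  comm_d : t₁ ≫ ψ.d = (qPull E.q).map (P.P.d 1 0) ≫ t₀.hom
  comm_a : ∀ V (p : (P.P.X 0).val V),
    (show V.obj from B.app ψ.a V (B.app t₀.hom V (qUnit E.q _ V p))) = B.app P.aug V p
  comm_b : ∀ V (m : M) (p : (P.P.X 0).val V) (w : (P.P.X 1).val V),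
    B.app (P.P.d 1 0) V w = E.i m • p →
    B.app ψ.b V (btmul R M m (show V.obj from B.app P.aug V p)) = B.app t₁ V (qUnit E.q _ V w)

/-- The elementary extension `φ` corresponds to the square-zero extension `E`: the object `q_*(I)`
has projective resolutions in `B(R, R')`, and for every such resolution `P` the truncation
`τ_{[0,1]} q^* P` is an elementary extension of `R` by `M` that lies in the same connected component
of the category of elementary extensions as `φ`. -/
def CorrespondsTo (E : SquareZeroExt R M R') (φ : ElemExt R M) : Prop :=
  Nonempty (ProjRes (qPushTaut E.q)) ∧
    ∀ P : ProjRes (qPushTaut E.q),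
      ∃ ψ : ElemExt R M, Nonempty (TruncationIso E P ψ) ∧ Zigzag φ ψ

end Correspondence

end

end MacLane

/-!
The reduced group ring functor `Q(V) = R'[V] / R'[0]` is projective in `B(R, R')`, maps onto
`q_*(I)` by `[v] ↦ v`, and carries the product `[v] ⊗ [w] ↦ [v ⊗ w]`. Let `K` be the kernel of the
augmentation. Since `Q` is pointwise flat, the connecting map of `0 → M → R' → R → 0` identifies
`M ⊗_R V` with the kernel of `q^*K(V) → q^*Q(V)`, and `q^*K → q^*Q` is an elementary extension. It
is multiplicative because `K` is an ideal of `Q` and `q^*` is compatible with products, `R'` being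
commutative. The same construction applied to the first term `P₀` of a projective resolution gives
the truncation `τ_{[0,1]} q^*P`, and a lift `Q → P₀` of the augmentation, which exists because `Q`
is projective, induces a map of elementary extensions.
-/

namespace MacLane

noncomputable section

section Descent

variable {R R' N C L : Type*} [Ring R] [Ring R'] {q : R' →+* R} [AddCommGroup N] [Module R' N]
  [AddCommGroup C] [Module R C] [AddCommGroup L] [Module R L] {η : N →ₛₗ[q] C}

theorem linearMap_ext_of_surjective (hη : Function.Surjective η) {f g : C →ₗ[R] L}
    (h : ∀ x, f (η x) = g (η x)) : f = g :=
  LinearMap.ext (hη.forall.2 h)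

variable [RingHomSurjective q]

/-- The linear map through which a semilinear map `g` factors along a surjective semilinear map
`η`. -/
def descend (hη : Function.Surjective η) (g : N →ₛₗ[q] L) (h : LinearMap.ker η ≤ LinearMap.ker g) :
    C →ₗ[R] L :=
  let f := η.toAddMonoidHom.liftOfSurjective hη ⟨g.toAddMonoidHom, h⟩
  have hf (x : N) : f (η x) = g x := AddMonoidHom.liftOfRightInverse_comp_apply _ _ _ _ x
  { f with
    map_smul' :=
      (RingHomSurjective.is_surjective (σ := q)).forall.2 fun r => hη.forall.2 fun x => by
        change f (q r • η x) = q r • f (η x)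
        rw [← map_smulₛₗ, hf, hf, map_smulₛₗ] }

@[simp]
theorem descend_apply (hη : Function.Surjective η) (g : N →ₛₗ[q] L)
    (h : LinearMap.ker η ≤ LinearMap.ker g) (x : N) : descend hη g h (η x) = g x :=
  AddMonoidHom.liftOfRightInverse_comp_apply η.toAddMonoidHom _
    (Function.rightInverse_surjInv hη) ⟨g.toAddMonoidHom, h⟩ x

end Descent

section Descent₂

variable {R R' N N' C C' L : Type*} [CommRing R] [Ring R'] {q : R' →+* R} [RingHomSurjective q]
  [AddCommGroup N] [Module R' N] [AddCommGroup N'] [Module R' N'] [AddCommGroup C] [Module R C]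
  [AddCommGroup C'] [Module R C'] [AddCommGroup L] [Module R L]
  {η : N →ₛₗ[q] C} {η' : N' →ₛₗ[q] C'}

/-- The bilinear map through which a bi-semilinear map `μ` factors along a pair of surjective
semilinear maps. -/
def descend₂ (hη : Function.Surjective η) (hη' : Function.Surjective η')
    (μ : N →ₛₗ[q] N' →ₛₗ[q] L) (h : LinearMap.ker η ≤ LinearMap.ker μ)
    (h' : ∀ x, LinearMap.ker η' ≤ LinearMap.ker (μ x)) : C →ₗ[R] C' →ₗ[R] L :=
  descend hη
    { toFun := fun x => descend hη' (μ x) (h' x)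
      map_add' := fun x y => linearMap_ext_of_surjective hη' fun z => by
        simp only [LinearMap.add_apply, descend_apply, map_add]
      map_smul' := fun r x => linearMap_ext_of_surjective hη' fun z => by
        simp only [LinearMap.smul_apply, descend_apply, map_smulₛₗ] }
    fun x hx => LinearMap.mem_ker.2 <| linearMap_ext_of_surjective hη' fun z =>
      (descend_apply hη' (μ x) (h' x) z).trans (LinearMap.congr_fun (h hx) z)

@[simp]
theorem descend₂_apply (hη : Function.Surjective η) (hη' : Function.Surjective η')
    (μ : N →ₛₗ[q] N' →ₛₗ[q] L) (h : LinearMap.ker η ≤ LinearMap.ker μ)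
    (h' : ∀ x, LinearMap.ker η' ≤ LinearMap.ker (μ x)) (x : N) (y : N') :
    descend₂ hη hη' μ h h' (η x) (η' y) = μ x y :=
  (LinearMap.congr_fun (descend_apply hη _ _ x) _).trans (descend_apply hη' (μ x) (h' x) y)

end Descent₂

section Reduction

variable {R R' N N' N'' C C' C'' L : Type*} [CommRing R] [CommRing R'] {q : R' →+* R}
  [AddCommGroup N] [Module R' N] [AddCommGroup N'] [Module R' N'] [AddCommGroup N'']
  [Module R' N''] [AddCommGroup C] [Module R C] [AddCommGroup C'] [Module R C'] [AddCommGroup C'']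
  [Module R C''] [AddCommGroup L] [Module R L]
  {η : N →ₛₗ[q] C} {η' : N' →ₛₗ[q] C'} {η'' : N'' →ₛₗ[q] C''}

theorem ker_smul_top_le_ker (g : N →ₛₗ[q] L) :
    RingHom.ker q • (⊤ : Submodule R' N) ≤ LinearMap.ker g :=
  Submodule.smul_le.2 fun r hr x _ => by
    rw [LinearMap.mem_ker, map_smulₛₗ, (RingHom.mem_ker).1 hr, zero_smul]

/-- The semilinear map `η : N → C` identifies `C` with `N / (ker q) N`. For surjective `q` this says
that `η` is, up to isomorphism, the map `N → R ⊗_{R'} N`, `x ↦ 1 ⊗ x`. -/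
structure IsReduction (η : N →ₛₗ[q] C) : Prop where
  surjective : Function.Surjective η
  ker_le : LinearMap.ker η ≤ RingHom.ker q • (⊤ : Submodule R' N)

namespace IsReduction

theorem of_bijective (hη : Function.Bijective η) : IsReduction η where
  surjective := hη.2
  ker_le := (LinearMap.ker_eq_bot.2 hη.1).trans_le bot_le

theorem exact (hη : Function.Surjective η) (hη' : Function.Surjective η') (hη'' : IsReduction η'')
    {f : N →ₗ[R'] N'} {g : N' →ₗ[R'] N''} {F : C →ₗ[R] C'} {G : C' →ₗ[R] C''}
    (hF : ∀ x, F (η x) = η' (f x)) (hG : ∀ x, G (η' x) = η'' (g x)) (hfg : Function.Exact f g)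
    (hg : Function.Surjective g) : Function.Exact F G := by
  refine hη'.forall.2 fun x => ⟨fun hx => ?_, ?_⟩
  · have hgx : g x ∈ (RingHom.ker q • (⊤ : Submodule R' N')).map g := by
      rw [Submodule.map_smul'', Submodule.map_top, LinearMap.range_eq_top.2 hg]
      exact hη''.ker_le ((hG x).symm.trans hx)
    obtain ⟨y, hy, hyx⟩ := hgx
    obtain ⟨z, hz⟩ := (hfg (x - y)).1 (by rw [map_sub, hyx, sub_self])
    have hy' : η' y = 0 := ker_smul_top_le_ker η' hy
    exact ⟨η z, by rw [hF, hz, map_sub, hy', sub_zero]⟩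
  · rintro ⟨c, hc⟩
    obtain ⟨z, rfl⟩ := hη c
    rw [← hc, hF, hG, hfg.apply_apply_eq_zero, map_zero]

variable [RingHomSurjective q]

/-- The linear map `C → L` induced by a semilinear map `N → L`. -/
def lift (hη : IsReduction η) (g : N →ₛₗ[q] L) : C →ₗ[R] L :=
  descend hη.surjective g (hη.ker_le.trans (ker_smul_top_le_ker g))

@[simp]
theorem lift_apply (hη : IsReduction η) (g : N →ₛₗ[q] L) (x : N) : hη.lift g (η x) = g x :=
  descend_apply _ _ _ x

/-- The bilinear map `C → C' → C''` induced by a bilinear map `N → N' → N''`. -/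
def map₂ (hη : IsReduction η) (hη' : IsReduction η') (η'' : N'' →ₛₗ[q] C'')
    (μ : N →ₗ[R'] N' →ₗ[R'] N'') : C →ₗ[R] C' →ₗ[R] C'' :=
  descend₂ hη.surjective hη'.surjective (μ.compr₂ₛₗ η'')
    (hη.ker_le.trans (ker_smul_top_le_ker _)) fun _ => hη'.ker_le.trans (ker_smul_top_le_ker _)

@[simp]
theorem map₂_apply (hη : IsReduction η) (hη' : IsReduction η') (η'' : N'' →ₛₗ[q] C'')
    (μ : N →ₗ[R'] N' →ₗ[R'] N'') (x : N) (y : N') :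
    hη.map₂ hη' η'' μ (η x) (η' y) = η'' (μ x y) :=
  descend₂_apply _ _ _ _ _ x y

end IsReduction

end Reduction

section BimodTensor

variable (R M V : Type u) [CommRing R] [AddCommGroup M] [Module R M] [Module Rᵐᵒᵖ M]
  [IsCentralScalar R M] [AddCommGroup V] [Module R V]

/-- For a diagonal bimodule `M`, the tensor product `M ⊗_R V` is the tensor product over the
commutative ring `R`. -/
def bimodTensorEquiv : BimodTensor R M V ≃ₗ[R] M ⊗[R] V :=
  let f : M →+ OpMod V →+ M ⊗[R] V :=
    (LinearMap.toAddMonoidHom'.comp (TensorProduct.mk R M V).toAddMonoidHom : M →+ V →+ M ⊗[R] V)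
  have hf (r : Rᵐᵒᵖ) (m : M) (v : OpMod V) : f (r • m) v = f m (r • v) := by
    rw [← MulOpposite.op_unop r, op_smul_eq_smul]
    exact smul_tmul r.unop m (show V from v)
  let g : M →ₗ[R] V →ₗ[R] BimodTensor R M V :=
    LinearMap.mk₂ R (btmul R M) (fun _ _ _ => add_tmul _ _ _) (fun _ _ _ => rfl)
      (fun _ _ _ => tmul_add _ _ _) fun r m v => by
        refine (tmul_smul (MulOpposite.op r) m (show OpMod V from v)).trans ?_
        rw [smul_tmul', op_smul_eq_smul]
        rfl
  have hfg (x : M ⊗[R] V) : liftAddHom f hf (TensorProduct.lift g x) = x := by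
    induction x using TensorProduct.induction_on with
    | zero => rw [map_zero, map_zero]
    | tmul m v => rfl
    | add x y hx hy => rw [map_add, map_add, hx, hy]
  have hgf (x : BimodTensor R M V) : TensorProduct.lift g (liftAddHom f hf x) = x := by
    induction x using TensorProduct.induction_on with
    | zero => rw [map_zero, map_zero]
    | tmul m v => rfl
    | add x y hx hy => rw [map_add, map_add, hx, hy]
  LinearEquiv.symm
    { toLinearMap := TensorProduct.lift g
      invFun := liftAddHom f hf
      left_inv := hfg
      right_inv := hgf }

variable {R M V} in
theorem bimodTensorEquiv_map [SMulCommClass Rᵐᵒᵖ R M] {W : Type u} [AddCommGroup W] [Module R W]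
    (f : V →ₗ[R] W) (z : BimodTensor R M V) :
    bimodTensorEquiv R M W (BimodTensor.map R M f z) = f.lTensor M (bimodTensorEquiv R M V z) := by
  induction z using TensorProduct.induction_on with
  | zero => simp only [map_zero]
  | tmul m v => rfl
  | add x y hx hy => simp only [map_add, hx, hy]

end BimodTensor

theorem tensorProduct_map_surjective {R R' M N P Q : Type*} [CommSemiring R] [CommSemiring R']
    {σ : R' →+* R} [AddCommMonoid M] [Module R M] [AddCommMonoid N] [Module R N]
    [AddCommMonoid P] [Module R' P] [AddCommMonoid Q] [Module R' Q] {f : P →ₛₗ[σ] M}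
    {g : Q →ₛₗ[σ] N} (hf : Function.Surjective f) (hg : Function.Surjective g) :
    Function.Surjective (TensorProduct.map f g) := fun z => by
  induction z using TensorProduct.induction_on with
  | zero => exact ⟨0, map_zero _⟩
  | tmul m n =>
    obtain ⟨x, rfl⟩ := hf m
    obtain ⟨y, rfl⟩ := hg n
    exact ⟨x ⊗ₜ y, map_tmul f g x y⟩
  | add z z' hz hz' =>
    obtain ⟨t, rfl⟩ := hz
    obtain ⟨t', rfl⟩ := hz'
    exact ⟨t + t', map_add _ _ _⟩

section Connecting

variable {R R' M K N V C C' : Type*} [CommRing R] [CommRing R'] {q : R' →+* R}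
  [AddCommGroup M] [Module R M] [AddCommGroup K] [Module R' K] [AddCommGroup N] [Module R' N]
  [AddCommGroup V] [Module R V] [AddCommGroup C] [Module R C] [AddCommGroup C'] [Module R C']
  {θ : RingHom.ker q →ₛₗ[q] M} {ι : K →ₗ[R'] N} {α : N →ₛₗ[q] V}

/-- For an exact sequence `0 → K → N → V` with `V` an `R`-module, the multiplication of elements of
`N` by elements of the kernel of `q`, with values in `K`. -/
def kerMul (hι : Function.Injective ι) (hex : Function.Exact ι α) :
    RingHom.ker q →ₗ[R'] N →ₗ[R'] K :=
  LinearMap.codRestrict₂ (LinearMap.lsmul R' N ∘ₗ (RingHom.ker q).subtype) ι hι fun r _ =>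
    (hex _).1 (ker_smul_top_le_ker α (Submodule.smul_mem_smul r.2 Submodule.mem_top))

@[simp]
theorem map_kerMul (hι : Function.Injective ι) (hex : Function.Exact ι α) (r : RingHom.ker q)
    (x : N) : ι (kerMul hι hex r x) = (r : R') • x :=
  LinearMap.codRestrict₂_apply _ _ _ _ _ _

theorem kerMul_map (hι : Function.Injective ι) (hex : Function.Exact ι α) (r : RingHom.ker q)
    (k : K) : kerMul hι hex r (ι k) = (r : R') • k :=
  hι (by rw [map_kerMul, map_smul])

theorem comp_lift_kerMul (hι : Function.Injective ι) (hex : Function.Exact ι α) :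
    ι ∘ₗ TensorProduct.lift (kerMul hι hex) =
      (TensorProduct.lid R' N).toLinearMap ∘ₗ (RingHom.ker q).subtype.rTensor N :=
  TensorProduct.ext' fun r x => map_kerMul hι hex r x

theorem range_comp_lift_kerMul (hι : Function.Injective ι) (hex : Function.Exact ι α) :
    LinearMap.range (ι ∘ₗ TensorProduct.lift (kerMul hι hex)) = RingHom.ker q • ⊤ := by
  rw [comp_lift_kerMul, Ideal.subtype_rTensor_range]

theorem lift_kerMul_injective [Module.Flat R' N] (hι : Function.Injective ι)
    (hex : Function.Exact ι α) : Function.Injective (TensorProduct.lift (kerMul hι hex)) := by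
  refine Function.Injective.of_comp (f := ι) ?_
  rw [← LinearMap.coe_comp, comp_lift_kerMul]
  exact (TensorProduct.lid R' N).injective.comp
    (Module.Flat.rTensor_preserves_injective_linearMap _ Subtype.val_injective)

variable [RingHomSurjective q]

/-- The connecting map `M ⊗_R V → C` of the exact sequence `0 → K → N → V → 0`, where `M` is the
kernel of `q` (through `θ`) and `C` is the reduction of `K`. When `N` is flat, its image is
`Tor₁^{R'}(R, V)`. -/
def conn (hθ : Function.Bijective θ) (hι : Function.Injective ι) (hex : Function.Exact ι α)
    (hα : Function.Surjective α) (η : K →ₛₗ[q] C) : M ⊗[R] V →ₗ[R] C :=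
  TensorProduct.lift <| descend₂ hθ.2 hα ((kerMul hι hex).compr₂ₛₗ η)
    ((LinearMap.ker_eq_bot.2 hθ.1).trans_le bot_le) fun r _ hx => by
      obtain ⟨k, rfl⟩ := (hex _).1 hx
      rw [LinearMap.mem_ker, LinearMap.compr₂ₛₗ_apply, kerMul_map]
      exact ker_smul_top_le_ker η (Submodule.smul_mem_smul r.2 Submodule.mem_top)

variable (hθ : Function.Bijective θ) (hι : Function.Injective ι) (hex : Function.Exact ι α)
  (hα : Function.Surjective α)

theorem conn_tmul (η : K →ₛₗ[q] C) {r : RingHom.ker q} {x : N} {k : K} (h : ι k = (r : R') • x) :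
    conn hθ hι hex hα η (θ r ⊗ₜ α x) = η k := by
  rw [conn, TensorProduct.lift.tmul, descend₂_apply, LinearMap.compr₂ₛₗ_apply]
  exact congrArg η (hι ((map_kerMul hι hex r x).trans h.symm))

theorem conn_map (η : K →ₛₗ[q] C) (t : RingHom.ker q ⊗[R'] N) :
    conn hθ hι hex hα η (TensorProduct.map θ α t) = η (TensorProduct.lift (kerMul hι hex) t) := by
  induction t using TensorProduct.induction_on with
  | zero => simp only [map_zero]
  | tmul r x => exact conn_tmul hθ hι hex hα η (map_kerMul hι hex r x)
  | add t t' ht ht' => simp only [map_add, ht, ht']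

theorem exact_conn {η : K →ₛₗ[q] C} {η' : N →ₛₗ[q] C'} (hη : Function.Surjective η)
    (hη' : IsReduction η') {F : C →ₗ[R] C'} (hF : ∀ k, F (η k) = η' (ι k)) :
    Function.Exact (conn hθ hι hex hα η) F := by
  have hrange := range_comp_lift_kerMul hι hex
  refine hη.forall.2 fun k => ⟨fun hk => ?_, fun ⟨z, hz⟩ => ?_⟩
  · obtain ⟨t, ht⟩ := hrange.ge (hη'.ker_le ((hF k).symm.trans hk))
    exact ⟨TensorProduct.map θ α t, by rw [conn_map, hι ht]⟩
  · obtain ⟨t, rfl⟩ := tensorProduct_map_surjective hθ.2 hα z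
    rw [← hz, conn_map, hF]
    exact ker_smul_top_le_ker η' (hrange.le ⟨t, rfl⟩)

theorem conn_injective [Module.Flat R' N] {η : K →ₛₗ[q] C} (hη : IsReduction η) :
    Function.Injective (conn hθ hι hex hα η) := by
  rw [injective_iff_map_eq_zero, (tensorProduct_map_surjective hθ.2 hα).forall]
  intro t ht
  have hker : RingHom.ker q • ⊤ ≤
      (LinearMap.ker (TensorProduct.map θ α)).map (TensorProduct.lift (kerMul hι hex)) :=
    Submodule.smul_le.2 fun r hr k _ => by
      refine ⟨⟨r, hr⟩ ⊗ₜ ι k, ?_, kerMul_map hι hex ⟨r, hr⟩ k⟩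
      exact (congrArg _ (hex.apply_apply_eq_zero k)).trans (tmul_zero _ _)
  obtain ⟨t', ht', htt'⟩ := hker (hη.ker_le ((conn_map hθ hι hex hα η t).symm.trans ht))
  rw [← lift_kerMul_injective hι hex htt', LinearMap.mem_ker.1 ht']

theorem map_conn {N' K' V' : Type*} [AddCommGroup N'] [Module R' N'] [AddCommGroup K']
    [Module R' K'] [AddCommGroup V'] [Module R V'] {ι' : K' →ₗ[R'] N'} {α' : N' →ₛₗ[q] V'}
    (hι' : Function.Injective ι') (hex' : Function.Exact ι' α') (hα' : Function.Surjective α')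
    {η : K →ₛₗ[q] C} {η' : K' →ₛₗ[q] C'} {k : K →ₗ[R'] K'} {n : N →ₗ[R'] N'} {v : V →ₗ[R] V'}
    {c : C →ₗ[R] C'} (hn : ∀ x, ι' (k x) = n (ι x)) (hv : ∀ x, v (α x) = α' (n x))
    (hc : ∀ x, c (η x) = η' (k x)) (z : M ⊗[R] V) :
    c (conn hθ hι hex hα η z) = conn hθ hι' hex' hα' η' (v.lTensor M z) := by
  have hnat : c ∘ₗ conn hθ hι hex hα η = conn hθ hι' hex' hα' η' ∘ₗ v.lTensor M :=
    TensorProduct.ext <| linearMap_ext_of_surjective hθ.2 fun r =>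
      linearMap_ext_of_surjective hα fun x => by
        change c (conn hθ hι hex hα η (θ r ⊗ₜ α x)) = conn hθ hι' hex' hα' η' (θ r ⊗ₜ v (α x))
        rw [conn_tmul hθ hι hex hα η (map_kerMul hι hex r x), hc, hv]
        exact (conn_tmul hθ hι' hex' hα' η' (by rw [hn, map_kerMul, map_smul])).symm
  exact LinearMap.congr_fun hnat z

end Connecting

section PointedFunctors

variable {R R' : Type u} [Ring R] [Ring R']

namespace B

variable {F G H : B R R'}

/-- The morphism of pointed functors with given natural components. -/
def mkHom (t : ∀ V, F.val V →ₗ[R'] G.val V)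
    (ht : ∀ {V W : RProj R} (f : V ⟶ W) x, t W (F.map f x) = G.map f (t V x)) : F ⟶ G :=
  ObjectProperty.homMk
    { app := fun V => ModuleCat.ofHom (t V)
      naturality := fun _ _ f => ModuleCat.hom_ext (LinearMap.ext fun x => ht f x) }

theorem hom_ext {s t : F ⟶ G} (h : ∀ V x, app s V x = app t V x) : s = t :=
  ObjectProperty.hom_ext _ <| NatTrans.ext <| funext fun V =>
    ModuleCat.hom_ext (LinearMap.ext (h V))

@[simp]
theorem app_comp (s : F ⟶ G) (t : G ⟶ H) (V : RProj R) (x : F.val V) :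
    app (s ≫ t) V x = app t V (app s V x) :=
  rfl

theorem app_map (t : F ⟶ G) {V W : RProj R} (f : V ⟶ W) (x : F.val V) :
    app t W (F.map f x) = G.map f (app t V x) :=
  LinearMap.congr_fun (congrArg ModuleCat.Hom.hom (t.hom.naturality f)) x

theorem map_comp (F : B R R') {U V W : RProj R} (f : U ⟶ V) (g : V ⟶ W) (x : F.val U) :
    F.map (f ≫ g) x = F.map g (F.map f x) :=
  LinearMap.congr_fun (congrArg ModuleCat.Hom.hom (F.obj.map_comp f g)) x

@[simp]
theorem map_id (F : B R R') (V : RProj R) (x : F.val V) : F.map (𝟙 V) x = x :=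
  LinearMap.congr_fun (congrArg ModuleCat.Hom.hom (F.obj.map_id V)) x

theorem map_zero_apply (F : B R R') (V W : RProj R) (x : F.val V) : F.map (0 : V ⟶ W) x = 0 := by
  let Z : RProj R := ⟨ModuleCat.of R PUnit, inferInstanceAs (Module.Finite R PUnit.{u + 1}),
    inferInstanceAs (Module.Projective R PUnit.{u + 1})⟩
  have hZ : Subsingleton (F.val Z) := F.property Z (inferInstanceAs (Subsingleton PUnit.{u + 1}))
  rw [← Limits.zero_comp (X := V) (f := (0 : Z ⟶ W)), map_comp, hZ.elim (F.map _ x) 0, map_zero]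

/-- The kernel of a morphism of pointed functors. -/
def ker (t : F ⟶ G) : B R R' where
  obj :=
    { obj := fun V => ModuleCat.of R' (LinearMap.ker (app t V))
      map := fun {V W} f => ModuleCat.ofHom <| (F.map f).restrict fun x hx => by
        rw [LinearMap.mem_ker, app_map, LinearMap.mem_ker.1 hx, map_zero]
      map_id := fun V => ModuleCat.hom_ext <| LinearMap.ext fun x => Subtype.ext (F.map_id V x.1)
      map_comp := fun f g =>
        ModuleCat.hom_ext <| LinearMap.ext fun x => Subtype.ext (F.map_comp f g x.1) }
  property := fun V hV =>
    have := F.property V hV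
    Subtype.val_injective.subsingleton

/-- The inclusion of the kernel. -/
def kerι (t : F ⟶ G) : ker t ⟶ F :=
  mkHom (fun V => (LinearMap.ker (app t V)).subtype) fun _ _ => rfl

theorem app_kerι_injective (t : F ⟶ G) (V : RProj R) : Function.Injective (app (kerι t) V) :=
  Subtype.val_injective

theorem exact_app_kerι (t : F ⟶ G) (V : RProj R) :
    Function.Exact (app (kerι t) V) (app t V) :=
  LinearMap.exact_subtype_ker_map (app t V)

/-- The factorization through the kernel of `t` of a morphism killed by `t`. -/
def kerLift (t : G ⟶ H) (s : F ⟶ G) (h : ∀ V x, app t V (app s V x) = 0) : F ⟶ ker t :=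
  mkHom (fun V => (app s V).codRestrict _ (h V)) fun f x => Subtype.ext (app_map s f x)

/-- The quotient of a functor by a subfunctor that contains its value at `0`. -/
def quotient (G : RProj R ⥤ ModuleCat.{u} R') (S : ∀ V, Submodule R' (G.obj V))
    (hS : ∀ {V W : RProj R} (f : V ⟶ W), S V ≤ (S W).comap (G.map f).hom)
    (h₀ : ∀ V : RProj R, Subsingleton V.obj → S V = ⊤) : B R R' where
  obj :=
    { obj := fun V => ModuleCat.of R' (G.obj V ⧸ S V)
      map := fun f => ModuleCat.ofHom (Submodule.mapQ _ _ (G.map f).hom (hS f))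
      map_id := fun V => ModuleCat.hom_ext <| Submodule.linearMap_qext _ <|
        congrArg (fun g => (S V).mkQ ∘ₗ ModuleCat.Hom.hom g) (G.map_id V)
      map_comp := fun {_ _ W} f g => ModuleCat.hom_ext <| Submodule.linearMap_qext _ <|
        congrArg (fun g => (S W).mkQ ∘ₗ ModuleCat.Hom.hom g) (G.map_comp f g) }
  property := fun V hV => Submodule.Quotient.subsingleton_iff.2 (h₀ V hV)

theorem surjective_of_epi (t : F ⟶ G) [Epi t] (V : RProj R) : Function.Surjective (app t V) := by
  let Q : B R R' := quotient G.obj (fun V => LinearMap.range (app t V))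
    (fun f => LinearMap.range_le_iff_comap.2 <| eq_top_iff.2 fun x _ =>
      ⟨F.map f x, app_map t f x⟩)
    fun V hV => have := G.property V hV; Subsingleton.elim _ _
  let π : G ⟶ Q := mkHom (fun V => (LinearMap.range (app t V)).mkQ) fun _ _ => rfl
  have hπ : π = 0 := (cancel_epi t).1 <| hom_ext fun V x =>
    (Submodule.Quotient.mk_eq_zero _).2 ⟨x, rfl⟩
  exact fun y => (Submodule.Quotient.mk_eq_zero (LinearMap.range (app t V))).1 <|
    show app π V y = 0 by rw [hπ]; rfl

theorem epi_of_surjective (t : F ⟶ G) (h : ∀ V, Function.Surjective (app t V)) : Epi t where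
  left_cancellation r s hrs := hom_ext fun V => (h V).forall.2 fun x => by
    rw [← app_comp, hrs, app_comp]

end B

end PointedFunctors

section Linearization

variable {R : Type u} (R' : Type u) [Ring R] [Ring R'] (S : RProj R ⥤ Type u)

/-- The pointed functor `V ↦ R'[S(V)] / R'[S(0)]` freely generated by a set-valued functor `S`.
The submodule `R'[S(0)]` is encoded as the image of the idempotent `R'[S(0 : V → V)]`. -/
def lin : B R R' :=
  B.quotient (S ⋙ ModuleCat.free R')
    (fun V => LinearMap.range ((S ⋙ ModuleCat.free R').map (0 : V ⟶ V)).hom)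
    (fun {V W} f => by
      rintro _ ⟨x, rfl⟩
      refine ⟨((S ⋙ ModuleCat.free R').map f).hom x, ?_⟩
      rw [← ModuleCat.comp_apply, ← ModuleCat.comp_apply, ← Functor.map_comp, ← Functor.map_comp,
        Limits.comp_zero, Limits.zero_comp])
    fun V hV => by
      have h : (0 : V ⟶ V) = 𝟙 V :=
        ObjectProperty.hom_ext _ (ModuleCat.hom_ext (LinearMap.ext fun _ => hV.elim _ _))
      rw [h, CategoryTheory.Functor.map_id]
      exact LinearMap.range_id

namespace lin

variable {R'} {S} {V W : RProj R} {N : Type u} [AddCommGroup N] [Module R' N]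

variable (V) in
/-- The projection of the free module on `S(V)` onto its quotient. -/
def mk : (ModuleCat.free R').obj (S.obj V) →ₗ[R'] (lin R' S).val V :=
  Submodule.mkQ _

/-- The generator `[s]`. -/
def of (s : S.obj V) : (lin R' S).val V :=
  mk V (ModuleCat.freeMk s)

@[simp]
theorem map_of (f : V ⟶ W) (s : S.obj V) : (lin R' S).map f (of s) = of (S.map f s) :=
  congrArg (mk W) (ModuleCat.free_map_apply _ _)

theorem hom_ext {R'' P : Type*} [Ring R''] [AddCommGroup P] [Module R'' P] {σ : R' →+* R''}
    {g h : (lin R' S).val V →ₛₗ[σ] P} (H : ∀ s, g (of s) = h (of s)) : g = h := by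
  apply Submodule.linearMap_qext
  exact Finsupp.lhom_ext' fun s => LinearMap.ext_ring (H s)

theorem of_zero (s : S.obj V) : (of (S.map (0 : V ⟶ V) s) : (lin R' S).val V) = 0 :=
  (map_of _ _).symm.trans (B.map_zero_apply _ _ _ _)

/-- The linear map with prescribed values on the generators. -/
def desc (g : S.obj V → N) (hg : ∀ s, g (S.map (0 : V ⟶ V) s) = 0) :
    (lin R' S).val V →ₗ[R'] N :=
  Submodule.liftQ _ (ModuleCat.freeDesc (M := ModuleCat.of R' N) (↾ g)).hom <|
    LinearMap.range_le_ker_iff.2 <| congrArg ModuleCat.Hom.hom <|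
      ModuleCat.free_hom_ext (M := ModuleCat.of R' N)
        (f := (S ⋙ ModuleCat.free R').map (0 : V ⟶ V) ≫ ModuleCat.freeDesc (↾ g)) (g := 0)
        fun s => by
          rw [ModuleCat.comp_apply, Functor.comp_map, ModuleCat.free_map_apply,
            ModuleCat.freeDesc_apply]
          exact hg s

@[simp]
theorem desc_of (g : S.obj V → N) (hg : ∀ s, g (S.map (0 : V ⟶ V) s) = 0) (s : S.obj V) :
    desc (R' := R') g hg (of s) = g s :=
  ModuleCat.freeDesc_apply (M := ModuleCat.of R' N) _ _

instance projective_val (V : RProj R) : Module.Projective R' ((lin R' S).val V) :=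
  have : Module.Projective R' ((ModuleCat.free R').obj (S.obj V)) :=
    inferInstanceAs (Module.Projective R' (S.obj V →₀ R'))
  Module.Projective.of_split
    (desc (fun s => ModuleCat.freeMk s - ModuleCat.freeMk (S.map (0 : V ⟶ V) s)) fun s => by
      rw [← Functor.map_comp_apply, Limits.comp_zero, sub_self])
    (mk V)
    (hom_ext fun s => by
      rw [LinearMap.comp_apply, desc_of, map_sub]
      exact (congrArg (of s - ·) (of_zero s)).trans (sub_zero _))

variable {F : B R R'}

/-- The morphism of pointed functors with prescribed values on the generators. -/
def descHom (g : ∀ V, S.obj V → F.val V)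
    (hg : ∀ {V W : RProj R} (f : V ⟶ W) s, g W (S.map f s) = F.map f (g V s)) : lin R' S ⟶ F :=
  have hg₀ (V : RProj R) (s : S.obj V) : g V (S.map (0 : V ⟶ V) s) = 0 := by
    rw [hg, B.map_zero_apply]
  B.mkHom (fun V => desc (g V) (hg₀ V)) fun {V W} f => LinearMap.congr_fun <|
    hom_ext (g := desc (g W) (hg₀ W) ∘ₗ (lin R' S).map f) (h := F.map f ∘ₗ desc (g V) (hg₀ V))
      fun s => by simp only [LinearMap.comp_apply, map_of, desc_of, hg]

@[simp]
theorem app_descHom_of (g : ∀ V, S.obj V → F.val V)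
    (hg : ∀ {V W : RProj R} (f : V ⟶ W) s, g W (S.map f s) = F.map f (g V s)) (V : RProj R)
    (s : S.obj V) : B.app (descHom g hg) V (of s) = g V s :=
  desc_of (g V) (fun s => by rw [hg, B.map_zero_apply]) s

/-- If `S` is freely generated by elements `s t ∈ S(W t)`, that is, if `S` is a disjoint union of
representable functors, then `lin R' S` is projective. -/
theorem projective {T : Type u} (W : T → RProj R) (s : ∀ t, S.obj (W t))
    (hs : ∀ V, Function.Bijective fun x : Σ t, W t ⟶ V => S.map x.2 (s x.1)) :
    Projective (lin R' S) where
  factors {E F} f e _ := by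
    choose y hy using fun t => B.surjective_of_epi e (W t) (B.app f (W t) (of (s t)))
    let x (V : RProj R) : S.obj V ≃ Σ t, W t ⟶ V := (Equiv.ofBijective _ (hs V)).symm
    have hx {V : RProj R} (t : T) (g : W t ⟶ V) : x V (S.map g (s t)) = ⟨t, g⟩ :=
      (Equiv.symm_apply_eq _).2 rfl
    let lift : lin R' S ⟶ E :=
      descHom (fun V a => E.map (x V a).2 (y (x V a).1)) fun {V _} g =>
        (hs V).2.forall.2 fun a => by rw [← Functor.map_comp_apply, hx, hx, B.map_comp]
    refine ⟨lift, B.hom_ext fun V => LinearMap.congr_fun <| hom_ext <|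
      (hs V).2.forall.2 fun a => ?_⟩
    rw [B.app_comp, app_descHom_of, hx, B.app_map, hy, ← B.app_map, map_of]

end lin

end Linearization

section Resolution

variable {R R' : Type u} [Ring R] [Ring R']

/-- The free module `Rⁿ` as an object of `R-proj`. -/
def RProj.free (R : Type u) [Ring R] (n : ℕ) : RProj R where
  obj := ModuleCat.of R (Fin n → R)
  property := ⟨inferInstanceAs (Module.Finite R (Fin n → R)),
    inferInstanceAs (Module.Projective R (Fin n → R))⟩

theorem RProj.exists_retract_free (V : RProj R) :
    ∃ (n : ℕ) (s : V ⟶ RProj.free R n) (r : RProj.free R n ⟶ V), s ≫ r = 𝟙 V := by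
  have := V.property.1
  have := V.property.2
  obtain ⟨n, r, s, -, -, h⟩ := Module.Finite.exists_comp_eq_id_of_projective R V.obj
  exact ⟨n, ObjectProperty.homMk (ModuleCat.ofHom s), ObjectProperty.homMk (ModuleCat.ofHom r),
    ObjectProperty.hom_ext _ (ModuleCat.hom_ext h)⟩

/-- The disjoint union of the functors represented by the objects `W t`. -/
def sumRep {T : Type u} (W : T → RProj R) : RProj R ⥤ Type u where
  obj V := Σ t, (W t ⟶ V)
  map f := ↾ fun x => ⟨x.1, x.2 ≫ f⟩

/-- The sum of the linearized representable functors `R'[Hom(Rⁿ, -)]` over all elements of the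
values `F(Rⁿ)`: it surjects onto `F` because finitely generated projective modules are retracts of
the `Rⁿ`. -/
def cover (F : B R R') : B R R' :=
  lin R' (sumRep fun t : Σ n, F.val (RProj.free R n) => RProj.free R t.1)

instance projective_cover (F : B R R') : Projective (cover F) :=
  lin.projective _ (fun t => ⟨t, 𝟙 _⟩) fun V => by
    refine (congrArg Function.Bijective (funext fun x => ?_)).mpr Function.bijective_id
    exact congrArg (Sigma.mk x.1) (Category.id_comp x.2)

/-- The canonical morphism from the cover. -/
def coverπ (F : B R R') : cover F ⟶ F :=
  lin.descHom (fun _ x => F.map x.2 x.1.2) fun f x => F.map_comp x.2 f x.1.2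

theorem app_coverπ_surjective (F : B R R') (V : RProj R) :
    Function.Surjective (B.app (coverπ F) V) := fun y => by
  obtain ⟨n, s, r, h⟩ := V.exists_retract_free
  refine ⟨lin.of ⟨⟨n, F.map s y⟩, r⟩, (lin.app_descHom_of (S := sumRep _) _
    (fun f x => F.map_comp x.2 f x.1.2) V _).trans ?_⟩
  rw [← B.map_comp, h, B.map_id]

theorem projective_val (F : B R R') [Projective F] (V : RProj R) :
    Module.Projective R' (F.val V) := by
  have := B.epi_of_surjective (coverπ F) (app_coverπ_surjective F)
  have : Module.Projective R' ((cover F).val V) := lin.projective_val V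
  refine Module.Projective.of_split (B.app (Projective.factorThru (𝟙 F) (coverπ F)) V)
    (B.app (coverπ F) V) (LinearMap.ext fun x => ?_)
  rw [LinearMap.comp_apply, ← B.app_comp, Projective.factorThru_comp]
  rfl

/-- The iterated kernels of the covers, starting from `X`. -/
def syzygy (X : B R R') : ℕ → B R R'
  | 0 => X
  | n + 1 => B.ker (coverπ (syzygy X n))

/-- The differential of the resolution by covers. -/
def syzygyD (X : B R R') (n : ℕ) : cover (syzygy X (n + 1)) ⟶ cover (syzygy X n) :=
  coverπ (syzygy X (n + 1)) ≫ B.kerι (coverπ (syzygy X n))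

theorem app_syzygyD_eq_zero_iff (X : B R R') (n : ℕ) (V : RProj R) (x) :
    B.app (syzygyD X n) V x = 0 ↔ B.app (coverπ (syzygy X (n + 1))) V x = 0 :=
  (B.app_kerι_injective (coverπ (syzygy X n)) V).eq_iff' (map_zero _)

theorem exact_syzygyD_coverπ (X : B R R') (n : ℕ) (V : RProj R) :
    Function.Exact (B.app (syzygyD X n) V) (B.app (coverπ (syzygy X n)) V) :=
  ((app_coverπ_surjective (syzygy X (n + 1)) V).comp_exact_iff_exact).2
    (B.exact_app_kerι (coverπ (syzygy X n)) V)

/-- The resolution of `X` by covers. -/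
def coverResolution (X : B R R') : ChainComplex (B R R') ℕ :=
  ChainComplex.of (fun n => cover (syzygy X n)) (syzygyD X) fun n => B.hom_ext fun V x =>
    (app_syzygyD_eq_zero_iff X n V _).2 ((exact_syzygyD_coverπ X (n + 1) V).apply_apply_eq_zero x)

theorem coverResolution_d (X : B R R') (n : ℕ) : (coverResolution X).d (n + 1) n = syzygyD X n :=
  ChainComplex.of_d (fun n => cover (syzygy X n)) (syzygyD X) n

end Resolution

theorem flat_val {R R' : Type u} [Ring R] [CommRing R'] (F : B R R') [Projective F]
    (V : RProj R) : Module.Flat R' (F.val V) :=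
  have := projective_val F V
  inferInstance

theorem nonempty_projRes {R R' : Type u} [CommRing R] [CommRing R'] (X : B R R') :
    Nonempty (ProjRes X) :=
  ⟨{
    P := coverResolution X
    projective := fun n => inferInstanceAs (Projective (cover (syzygy X n)))
    aug := coverπ X
    aug_surjective := app_coverπ_surjective X
    exact_zero := fun V => by
      rw [coverResolution_d]
      exact exact_syzygyD_coverπ X 0 V
    exact_succ := fun n V x => by
      rw [coverResolution_d, coverResolution_d]
      exact (app_syzygyD_eq_zero_iff X n V x).trans (exact_syzygyD_coverπ X (n + 1) V x) }⟩

section ExtensionOfScalars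

variable {R R' : Type u} [CommRing R] [CommRing R'] (q : R' →+* R)

/-- The map `F(V) → R ⊗_{R'} F(V)`, `x ↦ 1 ⊗ x`, as a semilinear map. -/
def qUnitₛₗ (F : B R R') (V : RProj R) : F.val V →ₛₗ[q] ((qPull q).obj F).val V where
  toFun := qUnit q F V
  map_add' := map_add _
  map_smul' r x := map_smul ((ModuleCat.extendRestrictScalarsAdj.{u, u, u} q).unit.app _).hom r x

theorem app_qPull_map {F G : B R R'} (t : F ⟶ G) (V : RProj R) (x : F.val V) :
    B.app ((qPull q).map t) V (qUnitₛₗ q F V x) = qUnitₛₗ q G V (B.app t V x) :=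
  rfl

theorem qPull_obj_map (F : B R R') {V W : RProj R} (f : V ⟶ W) (x : F.val V) :
    ((qPull q).obj F).map f (qUnitₛₗ q F V x) = qUnitₛₗ q F W (F.map f x) :=
  rfl

theorem isReduction_qUnitₛₗ [RingHomSurjective q] (F : B R R') (V : RProj R) :
    IsReduction (qUnitₛₗ q F V) := by
  let : Algebra R' R := q.toAlgebra
  have hq : Function.Surjective (Algebra.linearMap R' R) :=
    RingHomSurjective.is_surjective (σ := q)
  refine ⟨TensorProduct.mk_surjective R' (F.val V) R hq, fun x hx => ?_⟩
  have hex : Function.Exact (RingHom.ker q).subtype (Algebra.linearMap R' R) :=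
    LinearMap.exact_subtype_ker_map (Algebra.linearMap R' R)
  have hx₁ : (Algebra.linearMap R' R).rTensor (F.val V) (1 ⊗ₜ x) = 0 := by
    rw [LinearMap.rTensor_tmul, Algebra.linearMap_apply, map_one]
    exact hx
  obtain ⟨t, ht⟩ := (rTensor_exact (F.val V) hex hq _).1 hx₁
  rw [← Ideal.subtype_rTensor_range]
  exact ⟨t, (congrArg (TensorProduct.lid R' (F.val V)) ht).trans (one_smul R' x)⟩

end ExtensionOfScalars

section Augmentation

variable {R R' : Type u} [CommRing R] [CommRing R'] {q : R' →+* R} {Q : B R R'}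

variable (q) in
/-- The identity of `V`, as a semilinear map from `q_*(I)(V)` to `V`. -/
def qPushTautₛₗ (V : RProj R) : (qPushTaut q).val V →ₛₗ[q] V.obj where
  toFun := fun v : V.obj => v
  map_add' _ _ := rfl
  map_smul' _ _ := rfl

/-- The values of a morphism to `q_*(I)`, as elements of `V`. -/
def augₛₗ (aug : Q ⟶ qPushTaut q) (V : RProj R) : Q.val V →ₛₗ[q] V.obj :=
  (qPushTautₛₗ q V).comp (B.app aug V)

theorem augₛₗ_kerι (aug : Q ⟶ qPushTaut q) (V : RProj R) (k : (B.ker aug).val V) :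
    augₛₗ aug V (B.app (B.kerι aug) V k) = 0 :=
  (B.exact_app_kerι aug V).apply_apply_eq_zero k

variable [RingHomSurjective q]

/-- The morphism `q^*(Q) → I` adjoint to `Q → q_*(I)`. -/
def augPull (aug : Q ⟶ qPushTaut q) : (qPull q).obj Q ⟶ tautFunctor R :=
  B.mkHom (fun V => (isReduction_qUnitₛₗ q Q V).lift (augₛₗ aug V)) fun {V W} f =>
    (isReduction_qUnitₛₗ q Q V).surjective.forall.2 fun x =>
      ((isReduction_qUnitₛₗ q Q W).lift_apply (augₛₗ aug W) (Q.map f x)).trans <|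
        (B.app_map aug f x).trans <|
          congrArg f.hom.hom ((isReduction_qUnitₛₗ q Q V).lift_apply (augₛₗ aug V) x).symm

@[simp]
theorem app_augPull (aug : Q ⟶ qPushTaut q) (V : RProj R) (x : Q.val V) :
    B.app (augPull aug) V (qUnitₛₗ q Q V x) = augₛₗ aug V x :=
  (isReduction_qUnitₛₗ q Q V).lift_apply (augₛₗ aug V) x

theorem exact_app_augPull {aug : Q ⟶ qPushTaut q} (V : RProj R)
    (haug : Function.Surjective (B.app aug V)) :
    Function.Exact (B.app ((qPull q).map (B.kerι aug)) V) (B.app (augPull aug) V) :=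
  IsReduction.exact (isReduction_qUnitₛₗ q _ V).surjective (isReduction_qUnitₛₗ q Q V).surjective
    (IsReduction.of_bijective (η := qPushTautₛₗ q V) Function.bijective_id)
    (app_qPull_map q (B.kerι aug) V) (app_augPull aug V) (B.exact_app_kerι aug V) haug

end Augmentation

namespace SquareZeroExt

variable {R M R' : Type u} [CommRing R] [CommRing R'] [AddCommGroup M] [Module R M]
  [Module Rᵐᵒᵖ M] (E : SquareZeroExt R M R')

include E in
theorem op_smul (r : R) (m : M) : MulOpposite.op r • m = r • m := by
  obtain ⟨r, rfl⟩ := E.q_surjective r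
  apply E.i_injective
  rw [← E.i_mul, mul_comm, E.mul_i]

include E in
theorem isCentralScalar : IsCentralScalar R M :=
  ⟨E.op_smul⟩

instance ringHomSurjective : RingHomSurjective E.q :=
  ⟨E.q_surjective⟩

/-- The identification of `M` with the kernel of `q`. -/
def kerEquiv : M ≃+ RingHom.ker E.q :=
  AddEquiv.ofBijective (E.i.codRestrict (RingHom.ker E.q) E.exact.apply_apply_eq_zero)
    ⟨fun _ _ h => E.i_injective (congrArg Subtype.val h), fun r =>
      ((E.exact r).1 r.2).imp fun _ => Subtype.ext⟩

/-- The inverse identification of the kernel of `q` with `M`. -/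
def kerToM : RingHom.ker E.q →ₛₗ[E.q] M where
  toFun := E.kerEquiv.symm
  map_add' := map_add _
  map_smul' r := E.kerEquiv.surjective.forall.2 fun m => by
    rw [AddEquiv.symm_apply_apply, AddEquiv.symm_apply_eq]
    exact Subtype.ext (E.mul_i r m)

theorem kerToM_bijective : Function.Bijective E.kerToM :=
  E.kerEquiv.symm.bijective

theorem kerToM_kerEquiv (m : M) : E.kerToM (E.kerEquiv m) = m :=
  E.kerEquiv.symm_apply_apply m

section Truncation

variable {Q Q' : B R R'} {aug : Q ⟶ qPushTaut E.q}
  {aug' : Q' ⟶ qPushTaut E.q}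

/-- The connecting map `M ⊗_R V → q^*(K)(V)` of an exact sequence `0 → K → Q → q_*(I) → 0`. -/
def connApp (haug : ∀ V, Function.Surjective (B.app aug V)) (V : RProj R) :
    M ⊗[R] V.obj →ₗ[R] ((qPull E.q).obj (B.ker aug)).val V :=
  conn (α := augₛₗ aug V) E.kerToM_bijective (B.app_kerι_injective aug V)
    (B.exact_app_kerι aug V) (haug V) (qUnitₛₗ E.q (B.ker aug) V)

theorem qPull_map_connApp (haug : ∀ V, Function.Surjective (B.app aug V)) {V W : RProj R}
    (f : V ⟶ W) (z : M ⊗[R] V.obj) : ((qPull E.q).obj (B.ker aug)).map f (E.connApp haug V z) =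
      E.connApp haug W (f.hom.hom.lTensor M z) :=
  map_conn (n := Q.map f) (k := (B.ker aug).map f) E.kerToM_bijective _ _ _ _ _ _
    (B.app_map (B.kerι aug) f) (fun x => (B.app_map aug f x).symm)
    (qPull_obj_map E.q (B.ker aug) f) z

theorem app_qPull_map_connApp (haug : ∀ V, Function.Surjective (B.app aug V))
    (haug' : ∀ V, Function.Surjective (B.app aug' V)) {t : Q ⟶ Q'} {k : B.ker aug ⟶ B.ker aug'}
    (hk : k ≫ B.kerι aug' = B.kerι aug ≫ t) (ht : t ≫ aug' = aug) (V : RProj R)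
    (z : M ⊗[R] V.obj) :
    B.app ((qPull E.q).map k) V (E.connApp haug V z) = E.connApp haug' V z := by
  refine (map_conn (n := B.app t V) (v := LinearMap.id) (α' := augₛₗ aug' V) (k := B.app k V)
    (ι' := B.app (B.kerι aug') V) E.kerToM_bijective _ _ _ (B.app_kerι_injective aug' V)
    (B.exact_app_kerι aug' V) (haug' V) (fun x => congrArg (fun s => B.app s V x) hk)
    (fun x => (congrArg (fun s => augₛₗ s V x) ht).symm) (app_qPull_map E.q k V) z).trans ?_
  rw [LinearMap.lTensor_id]
  rfl

variable [SMulCommClass Rᵐᵒᵖ R M]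

/-- The connecting map `I(M) → q^*(K)` of an exact sequence `0 → K → Q → q_*(I) → 0`. -/
def connHom (haug : ∀ V, Function.Surjective (B.app aug V)) :
    bimodFunctor R M ⟶ (qPull E.q).obj (B.ker aug) :=
  have := E.isCentralScalar
  B.mkHom (fun V => E.connApp haug V ∘ₗ (bimodTensorEquiv R M V.obj).toLinearMap) fun {_ W} f z =>
    (congrArg (E.connApp haug W) (bimodTensorEquiv_map f.hom.hom z)).trans
      (E.qPull_map_connApp haug f _).symm

theorem app_connHom_btmul (haug : ∀ V, Function.Surjective (B.app aug V)) {V : RProj R} {m : M}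
    {x : Q.val V} {k : (B.ker aug).val V} (h : B.app (B.kerι aug) V k = E.i m • x) :
    B.app (E.connHom haug) V (btmul R M m (augₛₗ aug V x)) = qUnitₛₗ E.q (B.ker aug) V k := by
  have hm := conn_tmul (α := augₛₗ aug V) E.kerToM_bijective (B.app_kerι_injective aug V)
    (B.exact_app_kerι aug V) (haug V) (qUnitₛₗ E.q (B.ker aug) V) (r := E.kerEquiv m) h
  rwa [kerToM_kerEquiv] at hm

theorem connHom_comp_qPull_map (haug : ∀ V, Function.Surjective (B.app aug V))
    (haug' : ∀ V, Function.Surjective (B.app aug' V)) {t : Q ⟶ Q'} {k : B.ker aug ⟶ B.ker aug'}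
    (hk : k ≫ B.kerι aug' = B.kerι aug ≫ t) (ht : t ≫ aug' = aug) :
    E.connHom haug ≫ (qPull E.q).map k = E.connHom haug' :=
  B.hom_ext fun V _ => E.app_qPull_map_connApp haug haug' hk ht V _

theorem app_connHom_injective (haug : ∀ V, Function.Surjective (B.app aug V)) (V : RProj R)
    [Module.Flat R' (Q.val V)] : Function.Injective (B.app (E.connHom haug) V) :=
  have := E.isCentralScalar
  (conn_injective E.kerToM_bijective _ _ _ (isReduction_qUnitₛₗ E.q (B.ker aug) V)).comp
    (bimodTensorEquiv R M V.obj).injective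

theorem exact_app_connHom (haug : ∀ V, Function.Surjective (B.app aug V)) (V : RProj R) :
    Function.Exact (B.app (E.connHom haug) V) (B.app ((qPull E.q).map (B.kerι aug)) V) :=
  have := E.isCentralScalar
  ((bimodTensorEquiv R M V.obj).surjective.comp_exact_iff_exact).2 <|
    exact_conn E.kerToM_bijective _ _ _ (isReduction_qUnitₛₗ E.q (B.ker aug) V).surjective
      (isReduction_qUnitₛₗ E.q Q V) (app_qPull_map E.q (B.kerι aug) V)

/-- The elementary extension `0 → I(M) → q^*(K) → q^*(Q) → I → 0` attached to an exact sequence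
`0 → K → Q → q_*(I) → 0` with `Q` pointwise flat. -/
def trunc (haug : ∀ V, Function.Surjective (B.app aug V))
    (hflat : ∀ V, Module.Flat R' (Q.val V)) : ElemExt R M where
  C₁ := (qPull E.q).obj (B.ker aug)
  C₀ := (qPull E.q).obj Q
  b := E.connHom haug
  d := (qPull E.q).map (B.kerι aug)
  a := augPull aug
  b_injective V := have := hflat V; E.app_connHom_injective haug V
  exact₁ := E.exact_app_connHom haug
  exact₀ V := exact_app_augPull V (haug V)
  a_surjective V := (haug V).forall.2 fun x => ⟨_, app_augPull aug V x⟩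

/-- The map of elementary extensions induced by a morphism over `q_*(I)`. -/
def truncMap {haug : ∀ V, Function.Surjective (B.app aug V)}
    {haug' : ∀ V, Function.Surjective (B.app aug' V)} {hflat : ∀ V, Module.Flat R' (Q.val V)}
    {hflat' : ∀ V, Module.Flat R' (Q'.val V)} (t : Q ⟶ Q') (ht : t ≫ aug' = aug) :
    E.trunc haug hflat ⟶ E.trunc haug' hflat' :=
  have h (V : RProj R) (k : (B.ker aug).val V) : B.app aug' V (B.app (B.kerι aug ≫ t) V k) = 0 :=
    (congrArg (fun s => B.app s V k.1) ht).trans k.2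
  { f₁ := (qPull E.q).map (B.kerLift aug' (B.kerι aug ≫ t) h)
    f₀ := (qPull E.q).map t
    comm_b := E.connHom_comp_qPull_map haug haug'
      (k := B.kerLift aug' (B.kerι aug ≫ t) h) rfl ht
    comm_d := by
      change (qPull E.q).map _ ≫ (qPull E.q).map _ = (qPull E.q).map _ ≫ (qPull E.q).map _
      rw [← Functor.map_comp, ← Functor.map_comp]
      rfl
    comm_a := B.hom_ext fun V => (isReduction_qUnitₛₗ E.q Q V).surjective.forall.2 fun x =>
      (app_augPull aug' V (B.app t V x)).trans <|
        (congrArg (fun s => augₛₗ s V x) ht).trans (app_augPull aug V x).symm }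

/-- `E.trunc` computes the truncation `τ_{[0,1]} q^* P` of a projective resolution. -/
def truncationIso (P : ProjRes (qPushTaut E.q)) (hflat : ∀ V, Module.Flat R' ((P.P.X 0).val V)) :
    TruncationIso E P (E.trunc P.aug_surjective hflat) :=
  have h₀ (V : RProj R) : ∀ x, B.app P.aug V (B.app (P.P.d 1 0) V x) = 0 :=
    (P.exact_zero V).apply_apply_eq_zero
  let p : P.P.X 1 ⟶ B.ker P.aug := B.kerLift P.aug (P.P.d 1 0) h₀
  have hp (V : RProj R) : Function.Surjective (B.app p V) := fun k =>
    ((P.exact_zero V k.1).1 k.2).imp fun _ => Subtype.ext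
  have hdp (V : RProj R) : Function.Exact (B.app (P.P.d 2 1) V) (B.app p V) := fun w =>
    Subtype.ext_iff.trans (P.exact_succ 0 V w)
  { t₀ := Iso.refl _
    t₁ := (qPull E.q).map p
    t₁_surjective := fun V => (isReduction_qUnitₛₗ E.q _ V).surjective.forall.2 fun k =>
      (hp V k).elim fun w hw => ⟨qUnitₛₗ E.q _ V w, congrArg (qUnitₛₗ E.q _ V) hw⟩
    t₁_exact := fun V => IsReduction.exact (isReduction_qUnitₛₗ E.q _ V).surjective
      (isReduction_qUnitₛₗ E.q _ V).surjective (isReduction_qUnitₛₗ E.q _ V)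
      (app_qPull_map E.q (P.P.d 2 1) V) (app_qPull_map E.q p V) (hdp V) (hp V)
    comm_d := ((qPull E.q).map_comp p (B.kerι P.aug)).symm.trans (Category.comp_id _).symm
    comm_a := app_augPull P.aug
    comm_b := fun V _ _ w h => E.app_connHom_btmul P.aug_surjective (k := B.app p V w) h }

end Truncation

end SquareZeroExt

section Pairing

variable {R R' : Type u} [CommRing R] [CommRing R'] (q : R' →+* R) [RingHomSurjective q]
  {F F' G G' H H' K K' L : B R R'} {U U' V V' W W' X X' Y Y' : RProj R}

/-- The bilinear map on extensions of scalars along `q` induced by a bilinear map. -/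
def qPullMap₂ (μ : F.val V →ₗ[R'] G.val W →ₗ[R'] H.val X) :
    ((qPull q).obj F).val V →ₗ[R] ((qPull q).obj G).val W →ₗ[R] ((qPull q).obj H).val X :=
  (isReduction_qUnitₛₗ q F V).map₂ (isReduction_qUnitₛₗ q G W) (qUnitₛₗ q H X) μ

@[simp]
theorem qPullMap₂_qUnitₛₗ (μ : F.val V →ₗ[R'] G.val W →ₗ[R'] H.val X) (x : F.val V)
    (y : G.val W) :
    qPullMap₂ q μ (qUnitₛₗ q F V x) (qUnitₛₗ q G W y) = qUnitₛₗ q H X (μ x y) :=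
  IsReduction.map₂_apply _ _ _ _ x y

theorem forall_qPull_val (F : B R R') (V : RProj R) {p : ((qPull q).obj F).val V → Prop} :
    (∀ x, p x) ↔ ∀ x, p (qUnitₛₗ q F V x) :=
  (isReduction_qUnitₛₗ q F V).surjective.forall

theorem qPull_map_qPullMap₂ {μ : F.val V →ₗ[R'] G.val W →ₗ[R'] H.val X}
    {ν : F.val V' →ₗ[R'] G.val W' →ₗ[R'] H.val X'} {f : V ⟶ V'} {g : W ⟶ W'} {h : X ⟶ X'}
    (hμν : ∀ x y, H.map h (μ x y) = ν (F.map f x) (G.map g y)) :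
    ∀ x y, ((qPull q).obj H).map h (qPullMap₂ q μ x y) =
      qPullMap₂ q ν (((qPull q).obj F).map f x) (((qPull q).obj G).map g y) := by
  simp only [forall_qPull_val, qPullMap₂_qUnitₛₗ, qPull_obj_map, hμν, implies_true]

theorem app_qPullMap₂_right {μ : F.val V →ₗ[R'] G.val W →ₗ[R'] H.val X}
    {ν : F.val V →ₗ[R'] G'.val W →ₗ[R'] H'.val X} {s : G ⟶ G'} {t : H ⟶ H'}
    (hμν : ∀ x y, B.app t X (μ x y) = ν x (B.app s W y)) :
    ∀ x y, B.app ((qPull q).map t) X (qPullMap₂ q μ x y) =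
      qPullMap₂ q ν x (B.app ((qPull q).map s) W y) := by
  simp only [forall_qPull_val, qPullMap₂_qUnitₛₗ, app_qPull_map, hμν, implies_true]

theorem app_qPullMap₂_left {μ : F.val V →ₗ[R'] G.val W →ₗ[R'] H.val X}
    {ν : F'.val V →ₗ[R'] G.val W →ₗ[R'] H'.val X} {s : F ⟶ F'} {t : H ⟶ H'}
    (hμν : ∀ x y, B.app t X (μ x y) = ν (B.app s V x) y) :
    ∀ x y, B.app ((qPull q).map t) X (qPullMap₂ q μ x y) =
      qPullMap₂ q ν (B.app ((qPull q).map s) V x) y := by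
  simp only [forall_qPull_val, qPullMap₂_qUnitₛₗ, app_qPull_map, hμν, implies_true]

theorem qPullMap₂_balanced {μ : F'.val V →ₗ[R'] G.val W →ₗ[R'] H.val X}
    {ν : F.val V →ₗ[R'] G'.val W →ₗ[R'] H.val X} {s : F ⟶ F'} {t : G ⟶ G'}
    (hμν : ∀ x y, μ (B.app s V x) y = ν x (B.app t W y)) :
    ∀ x y, qPullMap₂ q μ (B.app ((qPull q).map s) V x) y =
      qPullMap₂ q ν x (B.app ((qPull q).map t) W y) := by
  simp only [forall_qPull_val, qPullMap₂_qUnitₛₗ, app_qPull_map, hμν, implies_true]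

theorem qPullMap₂_assoc {μ : F.val U →ₗ[R'] G.val V →ₗ[R'] K.val X}
    {ν : K.val X →ₗ[R'] H.val W →ₗ[R'] L.val Y} {μ' : G.val V →ₗ[R'] H.val W →ₗ[R'] K'.val X'}
    {ν' : F.val U →ₗ[R'] K'.val X' →ₗ[R'] L.val Y'} {f : Y ⟶ Y'}
    (h : ∀ x y z, L.map f (ν (μ x y) z) = ν' x (μ' y z)) :
    ∀ x y z, ((qPull q).obj L).map f (qPullMap₂ q ν (qPullMap₂ q μ x y) z) =
      qPullMap₂ q ν' x (qPullMap₂ q μ' y z) := by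
  simp only [forall_qPull_val, qPullMap₂_qUnitₛₗ, qPull_obj_map, h, implies_true]

theorem qPullMap₂_smul_one_left {μ : F.val V →ₗ[R'] G.val W →ₗ[R'] G.val X} {e : F.val V}
    {f : X ⟶ W} (h : ∀ x, G.map f (μ e x) = x) (r : R) :
    ∀ x, ((qPull q).obj G).map f (qPullMap₂ q μ (r • qUnitₛₗ q F V e) x) = r • x := by
  simp only [forall_qPull_val, map_smul, LinearMap.smul_apply, qPullMap₂_qUnitₛₗ, qPull_obj_map, h,
    implies_true]

theorem qPullMap₂_smul_one_right {μ : G.val V →ₗ[R'] F.val W →ₗ[R'] G.val X} {e : F.val W}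
    {f : X ⟶ V} (h : ∀ x, G.map f (μ x e) = x) :
    ∀ x (r : R), ((qPull q).obj G).map f (qPullMap₂ q μ x (r • qUnitₛₗ q F W e)) = r • x := by
  simp only [forall_qPull_val, map_smul, qPullMap₂_qUnitₛₗ, qPull_obj_map, h, implies_true]

end Pairing

section MulAugmentation

variable {R R' : Type u} [CommRing R] [CommRing R'] {q : R' →+* R} {Q : B R R'}

/-- The universal bilinear map `V × W → V ⊗_R W`. -/
def RProj.tmul (V W : RProj R) : V.obj →ₗ[R] W.obj →ₗ[R] (tensor V W).obj :=
  TensorProduct.mk R V.obj W.obj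

/-- An associative and unital product on the functor `Q` for which `aug : Q → q_*(I)` is
multiplicative. -/
structure MulAug (aug : Q ⟶ qPushTaut q) where
  one : Q.val (RProj.one R)
  mul : ∀ V W : RProj R, Q.val V →ₗ[R'] Q.val W →ₗ[R'] Q.val (RProj.tensor V W)
  map_mul : ∀ {V V' W W' : RProj R} (f : V ⟶ V') (g : W ⟶ W') x y,
    Q.map (RProj.tensorMap f g) (mul V W x y) = mul V' W' (Q.map f x) (Q.map g y)
  mul_assoc : ∀ U V W x y z,
    Q.map (RProj.assoc U V W) (mul _ W (mul U V x y) z) = mul U _ x (mul V W y z)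
  one_mul : ∀ V x, Q.map (RProj.lid V) (mul _ V one x) = x
  mul_one : ∀ V x, Q.map (RProj.rid V) (mul V _ x one) = x
  aug_one : augₛₗ aug (RProj.one R) one = (1 : R)
  aug_mul : ∀ V W x y, augₛₗ aug (RProj.tensor V W) (mul V W x y) =
    RProj.tmul V W (augₛₗ aug V x) (augₛₗ aug W y)

namespace MulAug

variable {aug : Q ⟶ qPushTaut q} (A : MulAug aug)

/-- The product `Q(V) ⊗ K(W) → K(V ⊗ W)`, where `K` is the kernel of the augmentation. -/
def mulKerRight (V W : RProj R) :
    Q.val V →ₗ[R'] (B.ker aug).val W →ₗ[R'] (B.ker aug).val (RProj.tensor V W) :=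
  LinearMap.codRestrict₂ ((A.mul V W).compl₂ (B.app (B.kerι aug) W)) (B.app (B.kerι aug) _)
    (B.app_kerι_injective aug _) fun x k => ⟨⟨A.mul V W x (B.app (B.kerι aug) W k),
      (A.aug_mul V W x _).trans ((congrArg _ (augₛₗ_kerι aug W k)).trans (map_zero _))⟩, rfl⟩

/-- The product `K(V) ⊗ Q(W) → K(V ⊗ W)`, where `K` is the kernel of the augmentation. -/
def mulKerLeft (V W : RProj R) :
    (B.ker aug).val V →ₗ[R'] Q.val W →ₗ[R'] (B.ker aug).val (RProj.tensor V W) :=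
  LinearMap.codRestrict₂ ((A.mul V W).comp (B.app (B.kerι aug) V)) (B.app (B.kerι aug) _)
    (B.app_kerι_injective aug _) fun k y => ⟨⟨A.mul V W (B.app (B.kerι aug) V k) y,
      (A.aug_mul V W _ y).trans ((LinearMap.congr_fun (congrArg _ (augₛₗ_kerι aug V k)) _).trans
        (LinearMap.map_zero₂ (RProj.tmul V W) _))⟩, rfl⟩

theorem app_kerι_mulKerRight (V W : RProj R) (x : Q.val V) (k : (B.ker aug).val W) :
    B.app (B.kerι aug) _ (A.mulKerRight V W x k) = A.mul V W x (B.app (B.kerι aug) W k) :=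
  LinearMap.codRestrict₂_apply _ _ _ _ x k

theorem app_kerι_mulKerLeft (V W : RProj R) (k : (B.ker aug).val V) (y : Q.val W) :
    B.app (B.kerι aug) _ (A.mulKerLeft V W k y) = A.mul V W (B.app (B.kerι aug) V k) y :=
  LinearMap.codRestrict₂_apply _ _ _ _ k y

end MulAug

end MulAugmentation

namespace SquareZeroExt

variable {R M R' : Type u} [CommRing R] [CommRing R'] [AddCommGroup M] [Module R M]
  [Module Rᵐᵒᵖ M] [SMulCommClass Rᵐᵒᵖ R M] (E : SquareZeroExt R M R') {Q : B R R'}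
  {aug : Q ⟶ qPushTaut E.q}

/-- The multiplicative structure on `E.trunc` induced by a product on `Q`. -/
def truncMult (A : MulAug aug) (haug : ∀ V, Function.Surjective (B.app aug V))
    (hflat : ∀ V, Module.Flat R' (Q.val V)) : MultStructure (E.trunc haug hflat) where
  e := LinearMap.toSpanSingleton R (((qPull E.q).obj Q).val (RProj.one R))
    (qUnitₛₗ E.q Q (RProj.one R) A.one)
  m₀₀ V W := qPullMap₂ E.q (A.mul V W)
  m₀₁ V W := qPullMap₂ E.q (A.mulKerRight V W)
  m₁₀ V W := qPullMap₂ E.q (A.mulKerLeft V W)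
  nat₀₀ f g := qPull_map_qPullMap₂ E.q (A.map_mul f g)
  nat₀₁ f g := qPull_map_qPullMap₂ E.q fun _ _ => B.app_kerι_injective aug _ <| by
    simp only [B.app_map, A.app_kerι_mulKerRight, A.map_mul]
  nat₁₀ f g := qPull_map_qPullMap₂ E.q fun _ _ => B.app_kerι_injective aug _ <| by
    simp only [B.app_map, A.app_kerι_mulKerLeft, A.map_mul]
  d_m₀₁ V W := app_qPullMap₂_right E.q (A.app_kerι_mulKerRight V W)
  d_m₁₀ V W := app_qPullMap₂_left E.q (A.app_kerι_mulKerLeft V W)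
  d_m₁₁ V W := qPullMap₂_balanced E.q fun _ _ => B.app_kerι_injective aug _ <| by
    rw [A.app_kerι_mulKerRight, A.app_kerι_mulKerLeft]
  assoc₀₀₀ U V W := qPullMap₂_assoc E.q (A.mul_assoc U V W)
  assoc₁₀₀ U V W := qPullMap₂_assoc E.q fun _ _ _ => B.app_kerι_injective aug _ <| by
    simp only [B.app_map, A.app_kerι_mulKerLeft, A.mul_assoc]
  assoc₀₁₀ U V W := qPullMap₂_assoc E.q fun _ _ _ => B.app_kerι_injective aug _ <| by
    simp only [B.app_map, A.app_kerι_mulKerLeft, A.app_kerι_mulKerRight, A.mul_assoc]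
  assoc₀₀₁ U V W := qPullMap₂_assoc E.q fun _ _ _ => B.app_kerι_injective aug _ <| by
    simp only [B.app_map, A.app_kerι_mulKerRight, A.mul_assoc]
  e_m₀₀ V := qPullMap₂_smul_one_left E.q (A.one_mul V)
  e_m₀₁ V := qPullMap₂_smul_one_left E.q fun _ => B.app_kerι_injective aug _ <| by
    rw [B.app_map, A.app_kerι_mulKerRight, A.one_mul]
  m₀₀_e V := qPullMap₂_smul_one_right E.q (A.mul_one V)
  m₁₀_e V := qPullMap₂_smul_one_right E.q fun _ => B.app_kerι_injective aug _ <| by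
    rw [B.app_map, A.app_kerι_mulKerLeft, A.mul_one]
  a_e r := (map_smul (B.app (augPull aug) _) r _).trans <|
    (congrArg (r • ·) ((app_augPull aug _ A.one).trans A.aug_one)).trans (mul_one r)
  a_m₀₀ V W := by
    change ∀ x y, B.app (augPull aug) _ (qPullMap₂ E.q (A.mul V W) x y) =
      RProj.tmul V W (B.app (augPull aug) V x) (B.app (augPull aug) W y)
    simp only [forall_qPull_val, qPullMap₂_qUnitₛₗ, app_augPull]
    exact A.aug_mul V W

end SquareZeroExt

section GroupRing

/-- The element `1` of the unit object `R` of `R-proj`. -/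
def RProj.unit (R : Type u) [CommRing R] : (RProj.one R).obj :=
  (1 : R)

/-- The reduced group ring functor `V ↦ R'[V] / R'[0]`. -/
def groupRing (R R' : Type u) [Ring R] [Ring R'] : B R R' :=
  lin R' ((isFGProj R).ι ⋙ forget (ModuleCat.{u} R))

namespace groupRing

section Generators

variable {R R' : Type u} [Ring R] [Ring R'] {V W : RProj R}

/-- The generator `[v]`. -/
def of (v : V.obj) : (groupRing R R').val V :=
  lin.of (S := (isFGProj R).ι ⋙ forget (ModuleCat.{u} R)) v

@[simp]
theorem map_of (f : V ⟶ W) (v : V.obj) : (groupRing R R').map f (of v) = of (f.hom.hom v) :=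
  lin.map_of (S := (isFGProj R).ι ⋙ forget (ModuleCat.{u} R)) f v

@[simp]
theorem of_zero (V : RProj R) : (of 0 : (groupRing R R').val V) = 0 :=
  lin.of_zero (S := (isFGProj R).ι ⋙ forget (ModuleCat.{u} R)) (0 : V.obj)

theorem hom_ext {R'' N : Type*} [Ring R''] [AddCommGroup N] [Module R'' N] {σ : R' →+* R''}
    {g h : (groupRing R R').val V →ₛₗ[σ] N} (H : ∀ v : V.obj, g (of v) = h (of v)) : g = h :=
  lin.hom_ext (S := (isFGProj R).ι ⋙ forget (ModuleCat.{u} R)) H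

variable {N : Type u} [AddCommGroup N] [Module R' N]

/-- The linear map with prescribed values on the generators. -/
def desc (g : V.obj → N) (hg : g 0 = 0) : (groupRing R R').val V →ₗ[R'] N :=
  lin.desc (S := (isFGProj R).ι ⋙ forget (ModuleCat.{u} R)) g fun _ => hg

@[simp]
theorem desc_of (g : V.obj → N) (hg : g 0 = 0) (v : V.obj) : desc (R' := R') g hg (of v) = g v :=
  lin.desc_of (S := (isFGProj R).ι ⋙ forget (ModuleCat.{u} R)) g (fun _ => hg) v

end Generators

variable {R R' : Type u} [CommRing R] [CommRing R']

instance projective : Projective (groupRing R R') :=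
  lin.projective (S := (isFGProj R).ι ⋙ forget (ModuleCat.{u} R)) (T := PUnit)
    (fun _ => RProj.one R) (fun _ => RProj.unit R) fun V => by
    refine ⟨fun ⟨_, f⟩ ⟨_, g⟩ h => ?_, fun v => ?_⟩
    · exact congrArg (Sigma.mk PUnit.unit)
        (ObjectProperty.hom_ext _ (ModuleCat.hom_ext (LinearMap.ext_ring h)))
    · exact ⟨⟨PUnit.unit,
        ObjectProperty.homMk (ModuleCat.ofHom (LinearMap.toSpanSingleton R V.obj v))⟩, one_smul R v⟩

section Augmentation

variable (q : R' →+* R) (V : RProj R)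

/-- The augmentation `[v] ↦ v`. -/
def aug : groupRing R R' ⟶ qPushTaut q :=
  lin.descHom (fun _ v => v) fun _ _ => rfl

@[simp]
theorem augₛₗ_aug_of (v : V.obj) : augₛₗ (aug q) V (of v) = v :=
  lin.app_descHom_of (S := (isFGProj R).ι ⋙ forget (ModuleCat.{u} R)) (F := qPushTaut q)
    (fun _ v => v) (fun _ _ => rfl) V v

theorem app_aug_surjective : Function.Surjective (B.app (aug q) V) := fun v =>
  ⟨of (V := V) v, augₛₗ_aug_of q V v⟩

end Augmentation

section Product

variable {U V V' W W' : RProj R}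

variable (V W) in
/-- The product `[v] ⊗ [w] ↦ [v ⊗ w]`. -/
def mul : (groupRing R R').val V →ₗ[R'] (groupRing R R').val W →ₗ[R']
    (groupRing R R').val (RProj.tensor V W) :=
  desc (fun v : V.obj => desc (fun w : W.obj => of (RProj.tmul V W v w))
    (by rw [map_zero, of_zero])) (hom_ext fun w => by
      rw [desc_of, LinearMap.map_zero₂, of_zero, LinearMap.zero_apply])

@[simp]
theorem mul_of_of (v : V.obj) (w : W.obj) :
    mul V W (of v) (of w) = (of (RProj.tmul V W v w) : (groupRing R R').val _) := by
  rw [mul, desc_of, desc_of]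

theorem map_mul (f : V ⟶ V') (g : W ⟶ W') (x : (groupRing R R').val V)
    (y : (groupRing R R').val W) : (groupRing R R').map (RProj.tensorMap f g) (mul V W x y) =
      mul V' W' ((groupRing R R').map f x) ((groupRing R R').map g y) := by
  suffices (mul V W).compr₂ ((groupRing R R').map (RProj.tensorMap f g)) =
      (mul V' W').compl₁₂ ((groupRing R R').map f) ((groupRing R R').map g) from
    LinearMap.congr_fun₂ this x y
  refine hom_ext fun v => hom_ext fun w => ?_
  simp only [LinearMap.compr₂_apply, LinearMap.compl₁₂_apply, mul_of_of, map_of]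
  rfl

theorem mul_assoc (U V W : RProj R) (x : (groupRing R R').val U) (y : (groupRing R R').val V)
    (z : (groupRing R R').val W) :
    (groupRing R R').map (RProj.assoc U V W) (mul _ W (mul U V x y) z) =
      mul U _ x (mul V W y z) := by
  let α := (groupRing R R').map (RProj.assoc U V W)
  have h₁ (u : U.obj) (v : V.obj) : α ∘ₗ mul _ W (mul U V (of u) (of v)) =
      mul U _ (of u) ∘ₗ mul V W (of v) :=
    hom_ext fun w => by
      simp only [α, LinearMap.comp_apply, mul_of_of, map_of]
      rfl
  have h₂ (u : U.obj) : α ∘ₗ (mul _ W).flip z ∘ₗ mul U V (of u) =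
      mul U _ (of u) ∘ₗ (mul V W).flip z :=
    hom_ext fun v => LinearMap.congr_fun (h₁ u v) z
  have h₃ : α ∘ₗ (mul _ W).flip z ∘ₗ (mul U V).flip y = (mul U _).flip (mul V W y z) :=
    hom_ext fun u => LinearMap.congr_fun (h₂ u) y
  exact LinearMap.congr_fun h₃ x

theorem one_mul (V : RProj R) (x : (groupRing R R').val V) :
    (groupRing R R').map (RProj.lid V) (mul _ V (of (RProj.unit R)) x) = x := by
  suffices (groupRing R R').map (RProj.lid V) ∘ₗ mul _ V (of (RProj.unit R)) =
    LinearMap.id from LinearMap.congr_fun this x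
  refine hom_ext fun v => ?_
  rw [LinearMap.comp_apply, mul_of_of, map_of]
  exact congrArg of (one_smul R v)

theorem mul_one (V : RProj R) (x : (groupRing R R').val V) :
    (groupRing R R').map (RProj.rid V) (mul V _ x (of (RProj.unit R))) = x := by
  suffices (groupRing R R').map (RProj.rid V) ∘ₗ (mul V _).flip (of (RProj.unit R)) =
    LinearMap.id from LinearMap.congr_fun this x
  refine hom_ext fun v => ?_
  rw [LinearMap.comp_apply, LinearMap.flip_apply, mul_of_of, map_of]
  exact congrArg of (one_smul R v)

theorem augₛₗ_mul (q : R' →+* R) (V W : RProj R) (x : (groupRing R R').val V)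
    (y : (groupRing R R').val W) : augₛₗ (aug q) (RProj.tensor V W) (mul V W x y) =
      RProj.tmul V W (augₛₗ (aug q) V x) (augₛₗ (aug q) W y) := by
  have h₁ (v : V.obj) : (augₛₗ (aug q) _).comp (mul V W (of v)) =
      (RProj.tmul V W v).comp (augₛₗ (aug q) W) :=
    hom_ext fun w => by
      simp only [LinearMap.comp_apply, mul_of_of, augₛₗ_aug_of]
  have h₂ : (augₛₗ (aug q) _).comp ((mul V W).flip y) =
      ((RProj.tmul V W).flip (augₛₗ (aug q) W y)).comp (augₛₗ (aug q) V) :=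
    hom_ext fun v => by
      simpa only [LinearMap.comp_apply, LinearMap.flip_apply, augₛₗ_aug_of] using
        LinearMap.congr_fun (h₁ v) y
  exact LinearMap.congr_fun h₂ x

/-- The product of the reduced group ring functor, as a multiplicative structure on its
augmentation. -/
def mulAug (q : R' →+* R) : MulAug (aug q) where
  one := of (RProj.unit R)
  mul := mul
  map_mul := map_mul
  mul_assoc := mul_assoc
  one_mul := one_mul
  mul_one := mul_one
  aug_one := augₛₗ_aug_of q _ _
  aug_mul := augₛₗ_mul q

end Product

end groupRing

end GroupRing

namespace SquareZeroExt

variable {R M R' : Type u} [CommRing R] [CommRing R'] [AddCommGroup M] [Module R M]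
  [Module Rᵐᵒᵖ M] [SMulCommClass Rᵐᵒᵖ R M] (E : SquareZeroExt R M R')

theorem correspondsTo_trunc {Q : B R R'} [Projective Q] {aug : Q ⟶ qPushTaut E.q}
    (haug : ∀ V, Function.Surjective (B.app aug V)) :
    CorrespondsTo E (E.trunc haug (flat_val Q)) := by
  refine ⟨nonempty_projRes _, fun P => ?_⟩
  have := P.projective 0
  have := B.epi_of_surjective P.aug P.aug_surjective
  exact ⟨E.trunc P.aug_surjective (flat_val _), ⟨E.truncationIso P (flat_val _)⟩,
    Zigzag.of_hom (E.truncMap _ (Projective.factorThru_comp aug P.aug))⟩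

end SquareZeroExt

end

end MacLane

theorem mainTheorem7 {R M R' : Type u} [CommRing R] [CommRing R'] [AddCommGroup M]
    [Module R M] [Module Rᵐᵒᵖ M] [SMulCommClass Rᵐᵒᵖ R M]
    (E : MacLane.SquareZeroExt R M R') :
    (∀ (r : R) (m : M), MulOpposite.op r • m = r • m) ∧
    ∃ φ : MacLane.ElemExt R M,
      Nonempty (MacLane.MultStructure φ) ∧ MacLane.CorrespondsTo E φ := by
  have haug := MacLane.groupRing.app_aug_surjective E.q
  have hflat := MacLane.flat_val (MacLane.groupRing R R')
  exact ⟨E.op_smul, E.trunc haug hflat, ⟨E.truncMult (MacLane.groupRing.mulAug E.q) haug hflat⟩,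
    E.correspondsTo_trunc haug⟩
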